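/- For $D \ge 2$ let $I = [-D/2, D/2]$ and $J = [-1/2, 1/2]$, and let $T = R_I P_J R_I$ on $L^2(\mathbb{R})$, where $R_I f = f$ on $I$ and $R_I f = 0$ on $\mathbb{R} \setminus I$, and $(P_J f)(x) = \int_J \int_{\mathbb{R}} f(y) e^{-2\pi i \omega (y - x)} \, dy \, d\omega$, understood as $P_J = \mathcal{F}^{-1} 1_J \mathcal{F}$ with $\mathcal{F}$ the unitary Fourier transform. The operator $T$ is compact and positive semidefinite with norm at most $1$; let $\lambda_1 \ge \lambda_2 \ge \cdots > 0$ be its positive eigenvalues, in non-increasing order and repeated according to multiplicity. Theorem. For each $\eta \in (0, 1/2]$ there exists a constant $A_\eta \ge 1$, depending only on $\eta$, such that the following holds. Given $\epsilon \in (0, 1/2)$ and $D \ge 2$, define $$K = A_\eta \cdot \bigl( \log( \log(D) \cdot \epsilon^{-1} ) \bigr)^{1 + \eta} \cdot \log( D \cdot \epsilon^{-1} ).$$ Then $$\{ k \in \mathbb{N} : k \ge 1,\ \lambda_k \in (\epsilon, 1 - \epsilon) \} \subset [D - K, D + K].$$ -/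

import Mathlib

open MeasureTheory FourierTransform

noncomputable section

/-- The complex Hilbert space `L²(ℝ)`, with respect to Lebesgue measure. -/
abbrev L2R : Type := Lp ℂ 2 (volume : Measure ℝ)

theorem memLp_indicator_Icc (a b : ℝ) (f : L2R) :
    MemLp ((Set.Icc a b).indicator (f : ℝ → ℂ)) 2 (volume : Measure ℝ) :=
  (Lp.memLp f).indicator measurableSet_Icc

/-- The linear map `f ↦ 1_I f` on `L²(ℝ)`, where `I = [a, b]`. -/
def timeLimitLin (a b : ℝ) : L2R →ₗ[ℂ] L2R where
  toFun f := MemLp.toLp ((Set.Icc a b).indicator (f : ℝ → ℂ)) (memLp_indicator_Icc a b f)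
  map_add' f g := by
    rw [← MemLp.toLp_add]
    apply MemLp.toLp_congr
    filter_upwards [Lp.coeFn_add f g] with x hx
    rw [Pi.add_apply] at hx ⊢
    by_cases h : x ∈ Set.Icc a b
    · simp only [Set.indicator_of_mem h]
      exact hx
    · simp only [Set.indicator_of_notMem h, add_zero]
  map_smul' c f := by
    rw [RingHom.id_apply, ← MemLp.toLp_const_smul]
    apply MemLp.toLp_congr
    filter_upwards [Lp.coeFn_smul c f] with x hx
    rw [Pi.smul_apply] at hx ⊢
    by_cases h : x ∈ Set.Icc a b
    · simp only [Set.indicator_of_mem h]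
      exact hx
    · simp only [Set.indicator_of_notMem h, smul_zero]

theorem norm_timeLimitLin_le (a b : ℝ) (f : L2R) : ‖timeLimitLin a b f‖ ≤ 1 * ‖f‖ := by
  rw [one_mul]
  apply Lp.norm_le_norm_of_ae_le
  have h : (timeLimitLin a b f : ℝ → ℂ) =ᵐ[volume] (Set.Icc a b).indicator (f : ℝ → ℂ) :=
    MemLp.coeFn_toLp (memLp_indicator_Icc a b f)
  filter_upwards [h] with x hx
  rw [hx]
  exact norm_indicator_le_norm_self _ _

/-- The time-limiting projection `R_I` on `L²(ℝ)`, where `I = [a, b]`: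
`(R_I f)(x) = f(x)` for `x ∈ I`, and `(R_I f)(x) = 0` for `x ∉ I`. -/
def timeLimit (a b : ℝ) : L2R →L[ℂ] L2R :=
  (timeLimitLin a b).mkContinuous 1 (norm_timeLimitLin_le a b)

/-- The band-limiting projection `P_J` on `L²(ℝ)`, where `J = [c, d]`:
`(P_J f)(x) = ∫_J ∫_ℝ f(y) e^{-2πiω(y - x)} dy dω`, that is, `P_J = 𝓕⁻¹ ∘ R_J ∘ 𝓕`, where `𝓕` is
the unitary Fourier transform on `L²(ℝ)`, `(𝓕 f)(ω) = ∫_ℝ f(y) e^{-2πiωy} dy`. -/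
def bandLimit (c d : ℝ) : L2R →L[ℂ] L2R :=
  ((Lp.fourierTransformₗᵢ ℝ ℂ).symm : L2R ≃L[ℂ] L2R).toContinuousLinearMap ∘L
    timeLimit c d ∘L
      ((Lp.fourierTransformₗᵢ ℝ ℂ) : L2R ≃L[ℂ] L2R).toContinuousLinearMap

/-- The time-frequency localization operator `T_{I,J} = R_I P_J R_I` on `L²(ℝ)`, with
`I = [a, b]` and `J = [c, d]`. -/
def timeFreqLoc (a b c d : ℝ) : L2R →L[ℂ] L2R :=
  timeLimit a b ∘L bandLimit c d ∘L timeLimit a b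

/-- For a compact positive operator `T` on a complex Hilbert space, `eigenvalueSeq T k` is the
`k`-th entry (`k = 1, 2, 3, …`) of the list of the positive eigenvalues of `T`, in non-increasing
order and repeated according to multiplicity: the largest `μ > 0` such that `T` has, counted with
multiplicity (by orthonormal eigenvectors), at least `k` eigenvalues that are `≥ μ`. -/
def eigenvalueSeq {H : Type*} [NormedAddCommGroup H] [InnerProductSpace ℂ H]
    (T : H →L[ℂ] H) (k : ℕ) : ℝ :=
  sSup {μ : ℝ | 0 < μ ∧ ∃ v : Fin k → H, Orthonormal ℂ v ∧
    ∀ i, ∃ ν : ℝ, μ ≤ ν ∧ T (v i) = (ν : ℂ) • v i}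

/-- The eigenvalues `λ₁ ≥ λ₂ ≥ ⋯ > 0` of `R_I P_J R_I`, where `I = [-D/2, D/2]` and
`J = [-1/2, 1/2]`. -/
def prolateEigenvalue (D : ℝ) (k : ℕ) : ℝ :=
  eigenvalueSeq (timeFreqLoc (-D / 2) (D / 2) (-1 / 2) (1 / 2)) k

end

/-! The idea is to study the leak `L = (1 - R_I) P_J R_I` (`timeFreqLeak`). By Pythagoras `‖L u‖²`
is diagonal in the eigenvectors of `T`, with value `λ(1 - λ)`, so it exceeds `ε/2` on unit vectors
spanned by eigenvectors with `λ ∈ (ε, 1 - ε)`.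

The leak has kernel `sinc(π(x - y))` with `y` inside `I` and `x` outside, singular only near the
endpoints. Cut `I` into `2M` dyadic Whitney pieces shrinking towards its endpoints. On a piece with
centre `c`, expand `1/(x - y)` in powers of `(y - c)/(x - c)`, a ratio of size at most `1/3`; `n`
terms impose `2n` moment conditions. A vector satisfying all `4Mn` conditions has `‖L u‖² ≤ (9⁻ⁿ · 8
log(1 + D) + 8 D 2⁻ᴹ) ‖u‖²` (`norm_sq_timeFreqLeak_le`). If that factor is at most `ε/2`, linear
algebra allows at most `4Mn` plunge eigenvalues (`card_le_of_eigenvalues_mem_Ioo`).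

To locate their indices, use that the trace of `T` is exactly `D` and that the Hilbert–Schmidt norm
of `L` gives `∑ λ(1 - λ) ≤ 8 log(1 + D)`. Comparing `∑ λ` with the number of eigenvalues above `ε`,
or at least `1 - ε`, costs only the plunge count and `2 ∑ λ(1 - λ)`. Hence `|k - D| ≤ 4Mn + 16 log(1
+ D)` (`abs_sub_le_of_prolateEigenvalue_mem_Ioo`).

Taking `M` of order `log(D/ε)` and `n` of order `log(log D / ε)` finishes. This gives exponent `1`
with an absolute constant, which is stronger than exponent `1 + η`. -/

/-! ### The `L²` Fourier transform as an integral. -/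

/-- Two locally integrable functions with the same pairings against Schwartz functions agree
almost everywhere. -/
theorem ae_eq_of_forall_schwartz_integral_eq {f g : ℝ → ℂ} (hf : LocallyIntegrable f)
    (hg : LocallyIntegrable g)
    (h : ∀ φ : SchwartzMap ℝ ℂ, ∫ x, φ x • f x = ∫ x, φ x • g x) : f =ᵐ[volume] g := by
  apply ae_eq_of_integral_contDiff_smul_eq hf hg
  intro φ hφ hc
  have h1 : HasCompactSupport (Complex.ofRealCLM ∘ φ) := hc.comp_left rfl
  have h2 : ContDiff ℝ (↑(⊤ : ℕ∞)) (Complex.ofRealCLM ∘ φ) := by fun_prop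
  simpa using h (h1.toSchwartzMap h2)

/-- Both sides define the same tempered distribution: against a Schwartz function, either transform
can be moved onto the test function. -/
theorem coeFn_fourier_L2_ae_eq (f : L2R) (hf : Integrable (f : ℝ → ℂ)) :
    (Lp.fourierTransformₗᵢ ℝ ℂ f : ℝ → ℂ) =ᵐ[volume] 𝓕 (f : ℝ → ℂ) := by
  have hcont : Continuous (𝓕 (f : ℝ → ℂ)) :=
    VectorFourier.fourierIntegral_continuous Real.continuous_fourierChar
      (by fun_prop) hf
  apply ae_eq_of_forall_schwartz_integral_eq
    ((Lp.memLp _).locallyIntegrable (by norm_num)) hcont.locallyIntegrable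
  intro φ
  have h1 := Lp.fourier_toTemperedDistribution_eq (E := ℝ) (F := ℂ) f
  have h2 := DFunLike.congr_fun h1 φ
  rw [TemperedDistribution.fourier_apply, Lp.toTemperedDistribution_apply,
    Lp.toTemperedDistribution_apply] at h2
  refine h2.symm.trans ?_
  have h3 := VectorFourier.integral_fourierIntegral_smul_eq_flip (L := innerₗ ℝ) (μ := volume)
    (ν := volume) (f := (φ : ℝ → ℂ)) (g := (f : ℝ → ℂ)) Real.continuous_fourierChar
    (by fun_prop) φ.integrable hf
  simp only [flip_innerₗ] at h3
  exact h3

theorem coeFn_fourierInv_L2_ae_eq (f : L2R) (hf : Integrable (f : ℝ → ℂ)) :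
    ((Lp.fourierTransformₗᵢ ℝ ℂ).symm f : ℝ → ℂ) =ᵐ[volume] 𝓕⁻ (f : ℝ → ℂ) := by
  have hcont : Continuous (𝓕⁻ (f : ℝ → ℂ)) :=
    VectorFourier.fourierIntegral_continuous Real.continuous_fourierChar (L := -innerₗ ℝ)
      (by simp only [LinearMap.neg_apply]; fun_prop) hf
  apply ae_eq_of_forall_schwartz_integral_eq
    ((Lp.memLp _).locallyIntegrable (by norm_num)) hcont.locallyIntegrable
  intro φ
  have h1 := Lp.fourierInv_toTemperedDistribution_eq (E := ℝ) (F := ℂ) f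
  have h2 := DFunLike.congr_fun h1 φ
  rw [TemperedDistribution.fourierInv_apply, Lp.toTemperedDistribution_apply,
    Lp.toTemperedDistribution_apply] at h2
  refine h2.symm.trans ?_
  have h3 := VectorFourier.integral_fourierIntegral_smul_eq_flip (L := -innerₗ ℝ) (μ := volume)
    (ν := volume) (f := (φ : ℝ → ℂ)) (g := (f : ℝ → ℂ)) Real.continuous_fourierChar
    (by simp only [LinearMap.neg_apply]; fun_prop) φ.integrable hf
  have h4 : (-innerₗ ℝ : ℝ →ₗ[ℝ] ℝ →ₗ[ℝ] ℝ).flip = -innerₗ ℝ := by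
    ext; simp
  rw [h4] at h3
  rw [SchwartzMap.fourierInv_coe]
  exact h3

/-! ### Hilbert–Schmidt operators and eigenbases. -/

section HilbertSpace

open scoped InnerProductSpace

variable {H : Type*} [NormedAddCommGroup H] [InnerProductSpace ℂ H]

/-- Orthonormal vectors are `√2` apart, so balls of radius `1/2` around them are disjoint.
Countability is needed to interchange a sum over a basis with an integral. -/
theorem Orthonormal.countable_index [TopologicalSpace.SeparableSpace H] {ι : Type*} {v : ι → H}
    (hv : Orthonormal ℂ v) : Countable ι := by
  refine Pairwise.countable_of_isOpen_disjoint (s := fun i => Metric.ball (v i) (1 / 2)) ?_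
    (fun _ => Metric.isOpen_ball) (fun i => ⟨v i, Metric.mem_ball_self (by norm_num)⟩)
  intro i j hij
  apply Metric.ball_disjoint_ball
  have h1 : ‖v i - v j‖ ^ 2 = 2 := by
    rw [norm_sub_sq (𝕜 := ℂ), hv.1 i, hv.1 j, hv.2 hij]
    norm_num
  rw [dist_eq_norm]
  nlinarith [norm_nonneg (v i - v j)]

theorem Orthonormal.norm_sq_sum {ι : Type*} [Fintype ι] {v : ι → H} (hv : Orthonormal ℂ v)
    (c : ι → ℂ) : ‖∑ i, c i • v i‖ ^ 2 = ∑ i, ‖c i‖ ^ 2 := by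
  have h := hv.inner_sum c c Finset.univ
  have h2 : ((‖∑ i, c i • v i‖ ^ 2 : ℝ) : ℂ) = ((∑ i, ‖c i‖ ^ 2 : ℝ) : ℂ) := by
    rw [inner_self_eq_norm_sq_to_K] at h
    push_cast
    simp only [Complex.conj_mul'] at h
    exact h
  exact_mod_cast h2

theorem HilbertBasis.hasSum_norm_inner_sq {ι : Type*} (b : HilbertBasis ι ℂ H) (x : H) :
    HasSum (fun i => ‖⟪x, b i⟫_ℂ‖ ^ 2) (‖x‖ ^ 2) := by
  have h := b.hasSum_inner_mul_inner x x
  rw [inner_self_eq_norm_sq_to_K] at h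
  have h1 : (fun i => ⟪x, b i⟫_ℂ * ⟪b i, x⟫_ℂ) = fun i => ((‖⟪x, b i⟫_ℂ‖ ^ 2 : ℝ) : ℂ) := by
    funext i
    rw [← inner_conj_symm (b i) x, Complex.mul_conj']
    push_cast
    rfl
  rw [h1] at h
  have h2 : ((‖x‖ : ℂ)) ^ 2 = ((‖x‖ ^ 2 : ℝ) : ℂ) := by push_cast; rfl
  erw [h2] at h
  exact Complex.hasSum_ofReal.mp h

theorem isCompactOperator_smulRight (φ : H →L[ℂ] ℂ) (x : H) :
    IsCompactOperator (φ.smulRight x) := by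
  have h : IsCompactOperator φ := isCompactOperator_of_locallyCompactSpace_dom φ
  exact h.clm_comp (ContinuousLinearMap.toSpanSingleton ℂ x)

/-- `S` is the operator-norm limit of the finite-rank sums of `u ↦ ⟪b i, u⟫ S (b i)`; Cauchy–Schwarz
and Bessel bound the tails by those of `∑ ‖S (b i)‖²`. -/
theorem isCompactOperator_of_summable_norm_sq [CompleteSpace H] {ι : Type*}
    (b : HilbertBasis ι ℂ H) (S : H →L[ℂ] H) (hS : Summable fun i => ‖S (b i)‖ ^ 2) :
    IsCompactOperator S := by
  set r : ι → H →L[ℂ] H := fun i => (innerSL ℂ (b i)).smulRight (S (b i)) with hr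
  have hbound : ∀ t : Finset ι, ‖∑ i ∈ t, r i‖ ≤ √(∑ i ∈ t, ‖S (b i)‖ ^ 2) := by
    intro t
    refine ContinuousLinearMap.opNorm_le_bound _ (Real.sqrt_nonneg _) fun u => ?_
    rw [sum_apply]
    calc ‖∑ i ∈ t, r i u‖ ≤ ∑ i ∈ t, ‖r i u‖ := norm_sum_le _ _
      _ = ∑ i ∈ t, ‖S (b i)‖ * ‖⟪b i, u⟫_ℂ‖ := by
          refine Finset.sum_congr rfl fun i _ => ?_
          simp [hr, norm_smul, mul_comm]
      _ ≤ √(∑ i ∈ t, ‖S (b i)‖ ^ 2) * √(∑ i ∈ t, ‖⟪b i, u⟫_ℂ‖ ^ 2) :=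
          Real.sum_mul_le_sqrt_mul_sqrt _ _ _
      _ ≤ √(∑ i ∈ t, ‖S (b i)‖ ^ 2) * ‖u‖ := by
          gcongr
          rw [Real.sqrt_le_left (norm_nonneg _)]
          exact b.orthonormal.sum_inner_products_le u
  have hsum : Summable r := by
    rw [summable_iff_vanishing_norm]
    intro ε hε
    obtain ⟨s, hs⟩ := summable_iff_vanishing_norm.mp hS (ε ^ 2) (by positivity)
    refine ⟨s, fun t ht => (hbound t).trans_lt ?_⟩
    rw [Real.sqrt_lt' hε]
    exact (le_abs_self _).trans_lt (hs t ht)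
  have hS' : HasSum r S := by
    have h := hsum.hasSum
    have he : ∑' i, r i = S := by
      ext u
      have h1 : HasSum (fun i => r i u) ((∑' i, r i) u) :=
        h.mapL (ContinuousLinearMap.apply ℂ H u)
      have h2 : HasSum (fun i => r i u) (S u) := by
        have h3 := (b.hasSum_repr u).mapL S
        simpa [hr, HilbertBasis.repr_apply_apply] using h3
      exact h1.unique h2
    rwa [he] at h
  refine isCompactOperator_of_tendsto hS' (Filter.Eventually.of_forall fun s => ?_)
  exact (compactOperator (RingHom.id ℂ) H H).sum_mem
    fun i _ => isCompactOperator_smulRight (innerSL ℂ (b i)) (S (b i))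

/-- Bases of the separate eigenspaces are glued; by the spectral theorem nothing is orthogonal to
all of them. The eigenvalue `0` is included, so that the trace can be computed in this basis. -/
theorem exists_hilbertBasis_eigenvectors.{u} {H : Type u} [NormedAddCommGroup H]
    [InnerProductSpace ℂ H] [CompleteSpace H] {T : H →L[ℂ] H}
    (hT : IsCompactOperator T) (hs : T.IsSymmetric) :
    ∃ (ι : Type u) (b : HilbertBasis ι ℂ H), ∀ i, ∃ μ : ℂ, T (b i) = μ • b i := by
  have hex : ∀ μ : ℂ, ∃ (w : Set (Module.End.eigenspace (T : Module.End ℂ H) μ))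
      (b : HilbertBasis w ℂ (Module.End.eigenspace (T : Module.End ℂ H) μ)), ⇑b = ((↑) : w → _) :=
    fun μ => by
      have hc : IsClosed ((Module.End.eigenspace (T : Module.End ℂ H) μ : Submodule ℂ H) : Set H) := by
        have : ((Module.End.eigenspace (T : Module.End ℂ H) μ : Submodule ℂ H) : Set H)
            = {x | T x = μ • x} := by
          ext x
          simp
        rw [this]
        exact isClosed_eq T.continuous (by fun_prop)
      have := hc.completeSpace_coe
      exact exists_hilbertBasis ℂ _
  choose w b hb using hex
  have ho : Orthonormal ℂ (fun a : Σ μ : ℂ, w μ => ((b a.1 a.2 : _) : H)) :=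
    hs.orthogonalFamily_eigenspaces.orthonormal_sigma_orthonormal fun μ => (b μ).orthonormal
  refine ⟨Σ μ : ℂ, w μ, HilbertBasis.mkOfOrthogonalEqBot ho ?_, ?_⟩
  · rw [Submodule.eq_bot_iff]
    intro x hx
    have h1 : x ∈ (⨆ μ, Module.End.eigenspace (T : Module.End ℂ H) μ)ᗮ := by
      rw [← Submodule.iInf_orthogonal, Submodule.mem_iInf]
      intro μ y hy
      have h2 := ((b μ).hasSum_repr ⟨y, hy⟩).mapL
        (Module.End.eigenspace (T : Module.End ℂ H) μ).subtypeL
      have h3 := (h2.mapL (innerSL ℂ x)).tsum_eq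
      have h4 : ⟪x, y⟫_ℂ = 0 := by
        refine Eq.trans h3.symm ?_
        refine (tsum_congr fun i => ?_).trans tsum_zero
        have h5 : ⟪((b μ i : _) : H), x⟫_ℂ = 0 :=
          hx _ (Submodule.subset_span ⟨⟨μ, i⟩, rfl⟩)
        have h6 : ⟪x, ((b μ i : _) : H)⟫_ℂ = 0 := inner_eq_zero_symm.mp h5
        simp only [map_smul, Submodule.subtypeL_apply, innerSL_apply_apply, h6, smul_zero]
      exact inner_eq_zero_symm.mp h4
    rwa [ContinuousLinearMap.orthogonalComplement_iSup_eigenspaces_eq_bot hT hs] at h1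
  · rintro ⟨μ, i⟩
    refine ⟨μ, ?_⟩
    rw [HilbertBasis.coe_mkOfOrthogonalEqBot]
    exact Module.End.mem_eigenspace_iff.mp (b μ i).2

/-! ### Algebra of a product `R P R` of projections. -/

section Projections

variable {R P : H →L[ℂ] H}

theorem isSymmetric_comp_comp (hRs : R.IsSymmetric) (hPs : P.IsSymmetric) :
    (R ∘L P ∘L R).IsSymmetric := by
  intro x y
  exact (hRs _ _).trans ((hPs _ _).trans (hRs _ _))

theorem inner_comp_comp_self (hRs : R.IsSymmetric) (hPs : P.IsSymmetric)
    (hP : ∀ x, P (P x) = P x) (u : H) :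
    ⟪(R ∘L P ∘L R) u, u⟫_ℂ = ((‖(P ∘L R) u‖ ^ 2 : ℝ) : ℂ) := by
  have h1 : ⟪R (P (R u)), u⟫_ℂ = ⟪P (R u), R u⟫_ℂ := hRs _ _
  have h2 : ⟪P (P (R u)), R u⟫_ℂ = ⟪P (R u), P (R u)⟫_ℂ := hPs _ _
  rw [hP] at h2
  have h3 : ⟪P (R u), P (R u)⟫_ℂ = ((‖P (R u)‖ : ℂ)) ^ 2 := inner_self_eq_norm_sq_to_K _
  simp only [ContinuousLinearMap.comp_apply]
  rw [h1, h2, h3]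
  push_cast
  rfl

/-- Pythagoras for `w = P R u`, split into `R w` and `w - R w`. -/
theorem norm_sq_sub_comp_comp (hRs : R.IsSymmetric) (hR : ∀ x, R (R x) = R x) (u : H) :
    ‖(P ∘L R - R ∘L P ∘L R) u‖ ^ 2 = ‖(P ∘L R) u‖ ^ 2 - ‖(R ∘L P ∘L R) u‖ ^ 2 := by
  simp only [sub_apply, ContinuousLinearMap.comp_apply]
  generalize P (R u) = w
  have h1 : ⟪w, R w⟫_ℂ = ⟪R w, R w⟫_ℂ := by
    have h : ⟪R w, R w⟫_ℂ = ⟪w, R (R w)⟫_ℂ := hRs _ _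
    rw [h, hR]
  rw [norm_sub_sq (𝕜 := ℂ), h1, inner_self_eq_norm_sq]
  ring

variable {ι : Type*} [Fintype ι] {v : ι → H} {ν : ι → ℝ}

theorem norm_sq_comp_sum_eigenvectors (hRs : R.IsSymmetric) (hPs : P.IsSymmetric)
    (hP : ∀ x, P (P x) = P x) (hv : Orthonormal ℂ v)
    (hν : ∀ i, (R ∘L P ∘L R) (v i) = (ν i : ℂ) • v i) (c : ι → ℂ) :
    ‖(P ∘L R) (∑ i, c i • v i)‖ ^ 2 = ∑ i, ‖c i‖ ^ 2 * ν i := by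
  have h := inner_comp_comp_self hRs hPs hP (∑ i, c i • v i)
  have h1 : (R ∘L P ∘L R) (∑ i, c i • v i) = ∑ i, (c i * ν i) • v i := by
    rw [map_sum]
    exact Finset.sum_congr rfl fun i _ => by rw [map_smul, hν, smul_smul]
  rw [h1, hv.inner_sum] at h
  have h2 : ((∑ i, ‖c i‖ ^ 2 * ν i : ℝ) : ℂ) =
      ((‖(P ∘L R) (∑ i, c i • v i)‖ ^ 2 : ℝ) : ℂ) := by
    rw [← h]
    push_cast
    refine Finset.sum_congr rfl fun i _ => ?_
    rw [map_mul, Complex.conj_ofReal, ← Complex.conj_mul']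
    ring
  exact_mod_cast h2.symm

theorem norm_sq_sub_comp_sum_eigenvectors (hRs : R.IsSymmetric) (hPs : P.IsSymmetric)
    (hR : ∀ x, R (R x) = R x) (hP : ∀ x, P (P x) = P x) (hv : Orthonormal ℂ v)
    (hν : ∀ i, (R ∘L P ∘L R) (v i) = (ν i : ℂ) • v i) (c : ι → ℂ) :
    ‖(P ∘L R - R ∘L P ∘L R) (∑ i, c i • v i)‖ ^ 2 = ∑ i, ‖c i‖ ^ 2 * (ν i * (1 - ν i)) := by
  rw [norm_sq_sub_comp_comp hRs hR, norm_sq_comp_sum_eigenvectors hRs hPs hP hv hν]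
  have h1 : (R ∘L P ∘L R) (∑ i, c i • v i) = ∑ i, (c i * ν i) • v i := by
    rw [map_sum]
    exact Finset.sum_congr rfl fun i _ => by rw [map_smul, hν, smul_smul]
  rw [h1, hv.norm_sq_sum, ← Finset.sum_sub_distrib]
  refine Finset.sum_congr rfl fun i _ => ?_
  rw [norm_mul, mul_pow, Complex.norm_real, Real.norm_eq_abs, sq_abs]
  ring

end Projections

/-! ### Hilbert–Schmidt norms from kernels. -/

section Kernel

variable {X : Type*} [MeasurableSpace X] {μ : Measure X} {g : X → H} {S : H →L[ℂ] H}

/-- `S` is given by the kernel `g`: the values of `S f` are the inner products `⟪g x, f⟫`, in the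
sense that their `L²` norms agree. -/
def IsKernelOperator (μ : Measure X) (g : X → H) (S : H →L[ℂ] H) : Prop :=
  ∀ f : H, AEMeasurable (fun x => ⟪g x, f⟫_ℂ) μ ∧ ‖S f‖ₑ ^ 2 = ∫⁻ x, ‖⟪g x, f⟫_ℂ‖ₑ ^ 2 ∂μ

theorem enorm_sq_eq_ofReal {E : Type*} [SeminormedAddGroup E] (x : E) :
    ‖x‖ₑ ^ 2 = ENNReal.ofReal (‖x‖ ^ 2) := by
  rw [ENNReal.ofReal_pow (norm_nonneg _), ofReal_norm]

/-- Interchange sum and integral, then apply Bessel to `g x` for each `x`. For a full basis Parseval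
turns this into an equality. -/
theorem IsKernelOperator.sum_enorm_sq_le (hS : IsKernelOperator μ g S) {ι : Type*} [Fintype ι]
    {v : ι → H} (hv : Orthonormal ℂ v) :
    ∑ i, ‖S (v i)‖ₑ ^ 2 ≤ ∫⁻ x, ‖g x‖ₑ ^ 2 ∂μ := by
  simp_rw [fun i => (hS (v i)).2]
  rw [← lintegral_finsetSum' _ fun i _ => ((hS (v i)).1.enorm.pow_const 2)]
  refine lintegral_mono fun x => ?_
  simp only [enorm_sq_eq_ofReal]
  rw [← ENNReal.ofReal_sum_of_nonneg fun _ _ => by positivity]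
  refine ENNReal.ofReal_le_ofReal ?_
  have h := hv.sum_inner_products_le (g x) (s := Finset.univ)
  simpa only [norm_inner_symm (g x)] using h

theorem IsKernelOperator.tsum_enorm_sq_eq (hS : IsKernelOperator μ g S) {ι : Type*} [Countable ι]
    (b : HilbertBasis ι ℂ H) : ∑' i, ‖S (b i)‖ₑ ^ 2 = ∫⁻ x, ‖g x‖ₑ ^ 2 ∂μ := by
  simp_rw [fun i => (hS (b i)).2]
  rw [← lintegral_tsum fun i => ((hS (b i)).1.enorm.pow_const 2)]
  refine lintegral_congr fun x => ?_
  simp only [enorm_sq_eq_ofReal]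
  have h := b.hasSum_norm_inner_sq (g x)
  rw [← ENNReal.ofReal_tsum_of_nonneg (fun _ => by positivity) h.summable, h.tsum_eq]

end Kernel

end HilbertSpace

/-! ### Kernels of the time- and band-limiting operators. -/

section Localization

open scoped InnerProductSpace ENNReal

theorem coeFn_timeLimit (a b : ℝ) (f : L2R) :
    (timeLimit a b f : ℝ → ℂ) =ᵐ[volume] (Set.Icc a b).indicator (f : ℝ → ℂ) :=
  MemLp.coeFn_toLp (memLp_indicator_Icc a b f)

theorem timeLimit_timeLimit (a b : ℝ) (f : L2R) :
    timeLimit a b (timeLimit a b f) = timeLimit a b f := by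
  apply Lp.ext
  filter_upwards [coeFn_timeLimit a b (timeLimit a b f), coeFn_timeLimit a b f] with x h1 h2
  rw [h1]
  by_cases hx : x ∈ Set.Icc a b
  · rw [Set.indicator_of_mem hx]
  · rw [Set.indicator_of_notMem hx, h2, Set.indicator_of_notMem hx]

theorem isSymmetric_timeLimit (a b : ℝ) : (timeLimit a b).IsSymmetric := by
  intro f g
  change ⟪timeLimit a b f, g⟫_ℂ = ⟪f, timeLimit a b g⟫_ℂ
  rw [L2.inner_def, L2.inner_def]
  apply integral_congr_ae
  filter_upwards [coeFn_timeLimit a b f, coeFn_timeLimit a b g] with x h1 h2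
  rw [h1, h2]
  by_cases hx : x ∈ Set.Icc a b
  · simp only [Set.indicator_of_mem hx]
  · simp only [Set.indicator_of_notMem hx, inner_zero_left, inner_zero_right]

theorem bandLimit_apply (c d : ℝ) (f : L2R) :
    bandLimit c d f =
      (Lp.fourierTransformₗᵢ ℝ ℂ).symm (timeLimit c d (Lp.fourierTransformₗᵢ ℝ ℂ f)) := rfl

theorem bandLimit_bandLimit (c d : ℝ) (f : L2R) :
    bandLimit c d (bandLimit c d f) = bandLimit c d f := by
  simp only [bandLimit_apply, LinearIsometryEquiv.apply_symm_apply, timeLimit_timeLimit]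

theorem isSymmetric_bandLimit (c d : ℝ) : (bandLimit c d).IsSymmetric := by
  intro f g
  change ⟪bandLimit c d f, g⟫_ℂ = ⟪f, bandLimit c d g⟫_ℂ
  rw [bandLimit_apply, bandLimit_apply, ← LinearIsometryEquiv.inner_map_map
    (Lp.fourierTransformₗᵢ ℝ ℂ), ← LinearIsometryEquiv.inner_map_map
    (Lp.fourierTransformₗᵢ ℝ ℂ) f]
  simp only [LinearIsometryEquiv.apply_symm_apply]
  exact isSymmetric_timeLimit c d _ _

theorem enorm_sq_L2_eq_lintegral (f : L2R) : ‖f‖ₑ ^ 2 = ∫⁻ x, ‖f x‖ₑ ^ 2 := by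
  rw [Lp.enorm_def, eLpNorm_eq_lintegral_rpow_enorm_toReal (by norm_num) (by norm_num),
    ← ENNReal.rpow_natCast, ← ENNReal.rpow_mul]
  simp

theorem integrableOn_Icc_L2 (a b : ℝ) (f : L2R) : IntegrableOn (f : ℝ → ℂ) (Set.Icc a b) :=
  ((Lp.memLp f).restrict (Set.Icc a b)).integrable one_le_two

theorem integrable_timeLimit (a b : ℝ) (f : L2R) : Integrable (timeLimit a b f : ℝ → ℂ) := by
  rw [integrable_congr (coeFn_timeLimit a b f), integrable_indicator_iff measurableSet_Icc]
  exact integrableOn_Icc_L2 a b f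

theorem memLp_indicator_Icc_of_continuous (a b : ℝ) {g : ℝ → ℂ} (hg : Continuous g) :
    MemLp ((Set.Icc a b).indicator g) 2 (volume : Measure ℝ) := by
  rw [memLp_indicator_iff_restrict measurableSet_Icc]
  obtain ⟨C, hC⟩ := isCompact_Icc.exists_bound_of_continuousOn (hg.continuousOn (s := Set.Icc a b))
  exact MemLp.of_bound hg.aestronglyMeasurable C
    ((ae_restrict_iff' measurableSet_Icc).mpr (Filter.Eventually.of_forall hC))

/-- The restriction of a continuous function to `[a, b]`, as an element of `L²(ℝ)`. -/
noncomputable def truncLp (a b : ℝ) (g : C(ℝ, ℂ)) : L2R :=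
  MemLp.toLp _ (memLp_indicator_Icc_of_continuous a b g.continuous)

theorem coeFn_truncLp (a b : ℝ) (g : C(ℝ, ℂ)) :
    (truncLp a b g : ℝ → ℂ) =ᵐ[volume] (Set.Icc a b).indicator g :=
  MemLp.coeFn_toLp _

theorem inner_truncLp (a b : ℝ) (g : C(ℝ, ℂ)) (f : L2R) :
    ⟪truncLp a b g, f⟫_ℂ = ∫ y in Set.Icc a b, (starRingEnd ℂ) (g y) * f y := by
  rw [L2.inner_def, ← integral_indicator measurableSet_Icc]
  apply integral_congr_ae
  filter_upwards [coeFn_truncLp a b g] with x h1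
  rw [h1]
  by_cases hx : x ∈ Set.Icc a b
  · simp only [Set.indicator_of_mem hx, RCLike.inner_apply]
    ring
  · simp only [Set.indicator_of_notMem hx, inner_zero_left]

theorem enorm_sq_truncLp (a b : ℝ) (g : C(ℝ, ℂ)) :
    ‖truncLp a b g‖ₑ ^ 2 = ∫⁻ y in Set.Icc a b, ‖g y‖ₑ ^ 2 := by
  rw [enorm_sq_L2_eq_lintegral, ← lintegral_indicator measurableSet_Icc]
  apply lintegral_congr_ae
  filter_upwards [coeFn_truncLp a b g] with x h1
  rw [h1]
  by_cases hx : x ∈ Set.Icc a b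
  · simp only [Set.indicator_of_mem hx]
  · simp [Set.indicator_of_notMem hx]

/-- The character `y ↦ e^{2πiωy}`. -/
noncomputable def expChar (ω : ℝ) : C(ℝ, ℂ) :=
  ⟨fun y => Complex.exp (2 * Real.pi * ω * y * Complex.I), by fun_prop⟩

theorem expChar_apply (ω y : ℝ) :
    expChar ω y = Complex.exp (2 * Real.pi * ω * y * Complex.I) := rfl

theorem norm_expChar (ω y : ℝ) : ‖expChar ω y‖ = 1 := by
  rw [expChar_apply]
  have h : (2 * Real.pi * ω * y * Complex.I : ℂ) = ((2 * Real.pi * ω * y : ℝ) : ℂ) * Complex.I := by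
    push_cast; ring
  rw [h, Complex.norm_exp_ofReal_mul_I]

theorem conj_expChar (ω y : ℝ) : (starRingEnd ℂ) (expChar ω y) = expChar (-ω) y := by
  rw [expChar_apply, expChar_apply, ← Complex.exp_conj]
  congr 1
  simp [Complex.conj_ofNat]

/-- The kernel `y ↦ sin(π(x - y)) / (π(x - y))` of the band-limiting projection to
`[-1/2, 1/2]`. -/
noncomputable def sincKernel (x : ℝ) : C(ℝ, ℂ) :=
  ⟨fun y => (Real.sinc (Real.pi * (x - y)) : ℂ), by
    have := Real.continuous_sinc
    fun_prop⟩

theorem sincKernel_apply (x y : ℝ) :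
    sincKernel x y = (Real.sinc (Real.pi * (x - y)) : ℂ) := rfl

theorem coeFn_fourier_timeLimit (a b : ℝ) (f : L2R) :
    (Lp.fourierTransformₗᵢ ℝ ℂ (timeLimit a b f) : ℝ → ℂ) =ᵐ[volume]
      fun ω => ⟪truncLp a b (expChar ω), f⟫_ℂ := by
  filter_upwards [coeFn_fourier_L2_ae_eq _ (integrable_timeLimit a b f)] with ω hω
  rw [hω, inner_truncLp, Real.fourier_real_eq_integral_exp_smul,
    ← integral_indicator measurableSet_Icc]
  apply integral_congr_ae
  filter_upwards [coeFn_timeLimit a b f] with y hy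
  rw [hy]
  by_cases h : y ∈ Set.Icc a b
  · rw [Set.indicator_of_mem h, Set.indicator_of_mem h, conj_expChar, expChar_apply, smul_eq_mul]
    congr 2
    push_cast
    ring
  · simp only [Set.indicator_of_notMem h, smul_zero]

theorem integral_exp_eq_sinc (t : ℝ) :
    ∫ ω in Set.Icc (-1 / 2 : ℝ) (1 / 2), Complex.exp (2 * Real.pi * ω * t * Complex.I)
      = (Real.sinc (Real.pi * t) : ℂ) := by
  rw [integral_Icc_eq_integral_Ioc, ← intervalIntegral.integral_of_le (by norm_num)]
  by_cases ht : t = 0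
  · subst ht
    simp only [Complex.ofReal_zero, mul_zero, zero_mul, Complex.exp_zero, Real.sinc_zero]
    rw [intervalIntegral.integral_const]
    norm_num
  · have hc : (2 * Real.pi * t * Complex.I : ℂ) ≠ 0 := by
      simp [Real.pi_ne_zero, ht]
    have h1 : ∀ ω : ℝ, (2 * Real.pi * ω * t * Complex.I : ℂ) = (2 * Real.pi * t * Complex.I) * ω :=
      fun ω => by ring
    simp_rw [h1]
    rw [integral_exp_mul_complex hc, Real.sinc_of_ne_zero (by positivity)]
    push_cast
    rw [Complex.sin]
    have h2 : (2 * Real.pi * t * Complex.I * (1 / 2) : ℂ) = Real.pi * t * Complex.I := by ring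
    have h3 : (2 * Real.pi * t * Complex.I * (-1 / 2) : ℂ) = -(Real.pi * t) * Complex.I := by ring
    rw [h2, h3]
    have hπ : (Real.pi : ℂ) ≠ 0 := by exact_mod_cast Real.pi_ne_zero
    have ht' : (t : ℂ) ≠ 0 := by exact_mod_cast ht
    have hI := Complex.I_ne_zero
    field_simp
    rw [Complex.I_sq]
    ring

/-- Time-limiting makes both Fourier integrals absolutely convergent; Fubini then integrates the
exponential over `J`, which produces the sinc. -/
theorem coeFn_bandLimit_timeLimit (a b : ℝ) (f : L2R) :
    (bandLimit (-1 / 2) (1 / 2) (timeLimit a b f) : ℝ → ℂ) =ᵐ[volume]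
      fun x => ⟪truncLp a b (sincKernel x), f⟫_ℂ := by
  rw [bandLimit_apply]
  filter_upwards [coeFn_fourierInv_L2_ae_eq _ (integrable_timeLimit (-1 / 2) (1 / 2)
    (Lp.fourierTransformₗᵢ ℝ ℂ (timeLimit a b f)))] with x hx
  rw [hx, Real.fourierInv_eq', inner_truncLp]
  have h1 : ∀ᵐ ω : ℝ, Complex.exp (↑(2 * Real.pi * ⟪ω, x⟫_ℝ) * Complex.I) •
        (timeLimit (-1 / 2) (1 / 2) (Lp.fourierTransformₗᵢ ℝ ℂ (timeLimit a b f)) : ℝ → ℂ) ω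
      = (Set.Icc (-1 / 2 : ℝ) (1 / 2)).indicator (fun ω : ℝ => ∫ y in Set.Icc a b,
          Complex.exp (2 * Real.pi * ω * ((x - y : ℝ) : ℂ) * Complex.I) * f y) ω := by
    filter_upwards [coeFn_timeLimit (-1 / 2) (1 / 2)
      (Lp.fourierTransformₗᵢ ℝ ℂ (timeLimit a b f)), coeFn_fourier_timeLimit a b f] with ω h2 h3
    rw [h2]
    by_cases h : ω ∈ Set.Icc (-1 / 2 : ℝ) (1 / 2)
    · rw [Set.indicator_of_mem h, Set.indicator_of_mem h, h3, inner_truncLp, smul_eq_mul,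
        ← integral_const_mul]
      congr 1
      funext y
      rw [conj_expChar, expChar_apply, ← mul_assoc, ← Complex.exp_add]
      congr 2
      simp only [RCLike.inner_apply, conj_trivial]
      push_cast
      ring
    · rw [Set.indicator_of_notMem h, Set.indicator_of_notMem h, smul_zero]
  rw [integral_congr_ae h1, integral_indicator measurableSet_Icc, integral_integral_swap]
  · congr 1
    funext y
    rw [integral_mul_const, integral_exp_eq_sinc, sincKernel_apply, Complex.conj_ofReal]
  · have hf : Integrable (fun z : ℝ × ℝ => f z.2)
        ((volume.restrict (Set.Icc (-1 / 2 : ℝ) (1 / 2))).prod (volume.restrict (Set.Icc a b))) :=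
      (integrableOn_Icc_L2 a b f).comp_snd _
    have hc : Continuous (fun z : ℝ × ℝ =>
        Complex.exp (2 * Real.pi * z.1 * ((x - z.2 : ℝ) : ℂ) * Complex.I)) := by fun_prop
    refine hf.bdd_mul (c := 1) hc.aestronglyMeasurable (Filter.Eventually.of_forall fun z => ?_)
    have h : (2 * Real.pi * z.1 * ((x - z.2 : ℝ) : ℂ) * Complex.I : ℂ)
        = ((2 * Real.pi * z.1 * (x - z.2) : ℝ) : ℂ) * Complex.I := by
      push_cast; ring
    rw [h, Complex.norm_exp_ofReal_mul_I]

/-- The outer inverse transform is an isometry, so the norm can be read on the frequency side, where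
the kernel has modulus one on `[c, d] × [a, b]`. This makes the trace exactly computable. -/
theorem isKernelOperator_bandLimit_timeLimit (a b c d : ℝ) :
    IsKernelOperator (volume.restrict (Set.Icc c d)) (fun ω => truncLp a b (expChar ω))
      (bandLimit c d ∘L timeLimit a b) := by
  intro f
  have h := coeFn_fourier_timeLimit a b f
  refine ⟨(((Lp.aestronglyMeasurable _).congr h).aemeasurable).restrict, ?_⟩
  rw [ContinuousLinearMap.comp_apply, bandLimit_apply]
  have h1 : ‖(Lp.fourierTransformₗᵢ ℝ ℂ).symm
      (timeLimit c d (Lp.fourierTransformₗᵢ ℝ ℂ (timeLimit a b f)))‖ₑ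
      = ‖timeLimit c d (Lp.fourierTransformₗᵢ ℝ ℂ (timeLimit a b f))‖ₑ := by
    rw [← ofReal_norm, ← ofReal_norm, LinearIsometryEquiv.norm_map]
  rw [h1, enorm_sq_L2_eq_lintegral, ← lintegral_indicator measurableSet_Icc]
  apply lintegral_congr_ae
  filter_upwards [h, coeFn_timeLimit c d (Lp.fourierTransformₗᵢ ℝ ℂ (timeLimit a b f))] with ω h2 h3
  rw [h3]
  by_cases hx : ω ∈ Set.Icc c d
  · simp only [Set.indicator_of_mem hx, h2]
  · simp [Set.indicator_of_notMem hx]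

/-- The off-diagonal part `(1 - R_I) P_J R_I` of the time-frequency localization, where
`I = [a, b]` and `J = [-1/2, 1/2]`. -/
noncomputable def timeFreqLeak (a b : ℝ) : L2R →L[ℂ] L2R :=
  bandLimit (-1 / 2) (1 / 2) ∘L timeLimit a b - timeFreqLoc a b (-1 / 2) (1 / 2)

theorem isKernelOperator_timeFreqLeak (a b : ℝ) :
    IsKernelOperator (volume.restrict (Set.Icc a b)ᶜ) (fun x => truncLp a b (sincKernel x))
      (timeFreqLeak a b) := by
  intro f
  have h := coeFn_bandLimit_timeLimit a b f
  refine ⟨(((Lp.aestronglyMeasurable _).congr h).aemeasurable).restrict, ?_⟩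
  rw [enorm_sq_L2_eq_lintegral, ← lintegral_indicator measurableSet_Icc.compl]
  apply lintegral_congr_ae
  set w := bandLimit (-1 / 2) (1 / 2) (timeLimit a b f)
  have h4 : timeFreqLeak a b f = w - timeLimit a b w := rfl
  rw [h4]
  filter_upwards [h, coeFn_timeLimit a b w, Lp.coeFn_sub w (timeLimit a b w)] with x h2 h3 h5
  rw [h5, Pi.sub_apply, h3]
  by_cases hx : x ∈ Set.Icc a b
  · simp [hx]
  · simp [hx, h2]

end Localization

/-! ### Integral bounds: logarithmic size of the leak, trace of `T`, compactness. -/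

section KernelBounds

open scoped ENNReal

/-- A majorant of `(sin(πt) / (πt))²`. -/
noncomputable def sincMajorant (t : ℝ) : ℝ≥0∞ := ENNReal.ofReal (4 / (1 + |t|) ^ 2)

theorem measurable_sincMajorant : Measurable sincMajorant := by
  unfold sincMajorant
  fun_prop

theorem sincMajorant_neg (t : ℝ) : sincMajorant (-t) = sincMajorant t := by
  rw [sincMajorant, abs_neg, sincMajorant]

theorem abs_sinc_pi_mul_le (t : ℝ) : |Real.sinc (Real.pi * t)| ≤ 2 / (1 + |t|) := by
  have ht := abs_nonneg t
  rw [le_div_iff₀ (by positivity)]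
  rcases le_or_gt |t| 1 with h | h
  · nlinarith [Real.abs_sinc_le_one (Real.pi * t), abs_nonneg (Real.sinc (Real.pi * t))]
  · have h0 : t ≠ 0 := by
      rintro rfl
      simp at h
      linarith
    have h1 : |Real.sinc (Real.pi * t)| * |t| ≤ 1 := by
      rw [Real.sinc_of_ne_zero (by positivity), abs_div, abs_mul, abs_of_pos Real.pi_pos,
        div_mul_eq_mul_div, div_le_one (by positivity)]
      have := Real.abs_sin_le_one (Real.pi * t)
      have := Real.pi_gt_three
      nlinarith
    nlinarith [abs_nonneg (Real.sinc (Real.pi * t))]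

theorem enorm_sq_sincKernel_le (x y : ℝ) : ‖sincKernel x y‖ₑ ^ 2 ≤ sincMajorant (x - y) := by
  rw [enorm_sq_eq_ofReal, sincMajorant, sincKernel_apply, Complex.norm_real, Real.norm_eq_abs]
  refine ENNReal.ofReal_le_ofReal ?_
  have h := pow_le_pow_left₀ (abs_nonneg _) (abs_sinc_pi_mul_le (x - y)) 2
  rw [div_pow] at h
  linarith

theorem setLIntegral_Ioi_sincMajorant {a y : ℝ} (h : y ≤ a) :
    ∫⁻ x in Set.Ioi a, sincMajorant (x - y) = ENNReal.ofReal (4 / (1 + a - y)) := by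
  have hd : ∀ x ∈ Set.Ici a,
      HasDerivAt (fun x => -4 / (1 + (x - y))) (4 / (1 + |x - y|) ^ 2) x := by
    intro x hx
    have hx' : 0 ≤ x - y := by have := Set.mem_Ici.mp hx; linarith
    rw [abs_of_nonneg hx']
    have h1 : HasDerivAt (fun x => 1 + (x - y)) 1 x :=
      ((hasDerivAt_id x).sub_const y).const_add 1
    convert! (hasDerivAt_const x (-4 : ℝ)).div h1 (by positivity) using 1
    ring
  have hlim : Filter.Tendsto (fun x : ℝ => -4 / (1 + (x - y))) Filter.atTop (nhds 0) := by
    apply Filter.Tendsto.div_atTop tendsto_const_nhds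
    apply Filter.tendsto_atTop_add_const_left
    exact Filter.tendsto_atTop_add_const_right _ _ Filter.tendsto_id
  have hpos : ∀ x ∈ Set.Ioi a, 0 ≤ 4 / (1 + |x - y|) ^ 2 := fun x _ => by positivity
  have hint := integrableOn_Ioi_deriv_of_nonneg' hd hpos hlim
  have hval := integral_Ioi_of_hasDerivAt_of_nonneg' hd hpos hlim
  have h2 := ofReal_integral_eq_lintegral_ofReal hint
    (Filter.Eventually.of_forall fun x => by positivity)
  rw [hval] at h2
  unfold sincMajorant
  rw [← h2]
  congr 1
  rw [zero_sub, neg_div, neg_neg, add_sub_assoc]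

theorem setLIntegral_Iio_sincMajorant {a y : ℝ} (h : a ≤ y) :
    ∫⁻ x in Set.Iio a, sincMajorant (x - y) = ENNReal.ofReal (4 / (1 + y - a)) := by
  have h1 := (Measure.measurePreserving_neg (volume : Measure ℝ)).setLIntegral_comp_preimage_emb
    (MeasurableEquiv.neg ℝ).measurableEmbedding (fun x => sincMajorant (x - y)) (Set.Iio a)
  rw [← h1]
  have h2 : (Neg.neg ⁻¹' Set.Iio a : Set ℝ) = Set.Ioi (-a) := by
    ext x
    simp
  rw [h2]
  have h3 : ∀ x : ℝ, sincMajorant (-x - y) = sincMajorant (x - -y) := fun x => by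
    rw [← sincMajorant_neg]
    congr 1
    ring
  simp_rw [h3]
  rw [setLIntegral_Ioi_sincMajorant (by linarith)]
  congr 2
  ring

theorem lintegral_sincMajorant_le (y : ℝ) : ∫⁻ x, sincMajorant (x - y) ≤ 8 := by
  rw [← setLIntegral_univ, ← Set.Iic_union_Ioi (a := y)]
  refine (lintegral_union_le _ _ _).trans ?_
  rw [setLIntegral_congr Iio_ae_eq_Iic.symm, setLIntegral_Iio_sincMajorant le_rfl,
    setLIntegral_Ioi_sincMajorant le_rfl, ← ENNReal.ofReal_add (by norm_num) (by norm_num)]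
  norm_num

theorem setLIntegral_compl_Icc_sincMajorant_le {r y : ℝ} (hy : y ∈ Set.Icc (-r) r) :
    ∫⁻ x in (Set.Icc (-r) r)ᶜ, sincMajorant (x - y)
      ≤ ENNReal.ofReal (4 / (1 + r - y) + 4 / (1 + r + y)) := by
  have h1 : (Set.Icc (-r) r)ᶜ = Set.Ioi r ∪ Set.Iio (-r) := by
    ext x
    simp only [Set.mem_compl_iff, Set.mem_Icc, Set.mem_union, Set.mem_Ioi, Set.mem_Iio,
      not_and_or, not_le, or_comm]
  have h2 : 0 ≤ r - y := by linarith [hy.2]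
  have h3 : 0 ≤ r + y := by linarith [hy.1]
  rw [h1]
  refine (lintegral_union_le _ _ _).trans ?_
  rw [setLIntegral_Ioi_sincMajorant hy.2, setLIntegral_Iio_sincMajorant hy.1,
    ← ENNReal.ofReal_add (by rw [add_sub_assoc]; positivity)
      (by rw [sub_neg_eq_add, add_assoc, add_comm y r]; positivity)]
  refine ENNReal.ofReal_le_ofReal (le_of_eq ?_)
  congr 2
  ring

theorem integral_edge_weight {r : ℝ} (hr : 0 ≤ r) :
    ∫ y in -r..r, (4 / (1 + r - y) + 4 / (1 + r + y)) = 8 * Real.log (1 + 2 * r) := by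
  have hpos : ∀ y ∈ Set.uIcc (-r) r, 0 < 1 + r - y ∧ 0 < 1 + r + y := by
    intro y hy
    rw [Set.uIcc_of_le (by linarith)] at hy
    exact ⟨by linarith [hy.2], by linarith [hy.1]⟩
  rw [intervalIntegral.integral_eq_sub_of_hasDerivAt
    (f := fun y => 4 * Real.log (1 + r + y) - 4 * Real.log (1 + r - y))]
  · have e1 : 1 + r + r = 1 + 2 * r := by ring
    have e2 : 1 + r - -r = 1 + 2 * r := by ring
    have e3 : 1 + r - r = 1 := by ring
    have e4 : 1 + r + -r = 1 := by ring
    simp only [e1, e2, e3, e4, Real.log_one]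
    ring
  · intro y hy
    obtain ⟨h1, h2⟩ := hpos y hy
    have d1 : HasDerivAt (fun y => 1 + r + y) 1 y := (hasDerivAt_id y).const_add _
    have d2 : HasDerivAt (fun y => 1 + r - y) (-1) y := (hasDerivAt_id y).const_sub _
    convert! ((d1.log h2.ne').const_mul 4).sub ((d2.log h1.ne').const_mul 4) using 1
    ring
  · apply ContinuousOn.intervalIntegrable
    refine ContinuousOn.add ?_ ?_
    · exact continuousOn_const.div (by fun_prop) fun y hy => (hpos y hy).1.ne'
    · exact continuousOn_const.div (by fun_prop) fun y hy => (hpos y hy).2.ne'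

/-- The majorant decays quadratically, so a point at distance `d` from an endpoint contributes `4/(1
+ d)` there; integrating over the interval gives the logarithm. -/
theorem lintegral_lintegral_sincMajorant_le {r : ℝ} (hr : 0 ≤ r) :
    ∫⁻ y in Set.Icc (-r) r, ∫⁻ x in (Set.Icc (-r) r)ᶜ, sincMajorant (x - y)
      ≤ ENNReal.ofReal (8 * Real.log (1 + 2 * r)) := by
  have h1 : ∫⁻ y in Set.Icc (-r) r, ∫⁻ x in (Set.Icc (-r) r)ᶜ, sincMajorant (x - y)
      ≤ ∫⁻ y in Set.Icc (-r) r, ENNReal.ofReal (4 / (1 + r - y) + 4 / (1 + r + y)) :=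
    setLIntegral_mono' measurableSet_Icc fun y hy => setLIntegral_compl_Icc_sincMajorant_le hy
  refine h1.trans (le_of_eq ?_)
  rw [← integral_edge_weight hr, intervalIntegral.integral_of_le (by linarith),
    ← integral_Icc_eq_integral_Ioc, ofReal_integral_eq_lintegral_ofReal]
  · apply ContinuousOn.integrableOn_Icc
    refine ContinuousOn.add ?_ ?_
    · exact continuousOn_const.div (by fun_prop) fun y hy => by linarith [hy.2]
    · exact continuousOn_const.div (by fun_prop) fun y hy => by linarith [hy.1]
  · refine (ae_restrict_iff' measurableSet_Icc).mpr (Filter.Eventually.of_forall fun y hy => ?_)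
    have h2 : 0 ≤ r - y := by linarith [hy.2]
    have h3 : 0 ≤ r + y := by linarith [hy.1]
    change 0 ≤ 4 / (1 + r - y) + 4 / (1 + r + y)
    rw [add_sub_assoc, add_assoc 1 r y]
    positivity

theorem measurable_sincMajorant_sub :
    Measurable (fun z : ℝ × ℝ => sincMajorant (z.1 - z.2)) :=
  measurable_sincMajorant.comp (by fun_prop)

theorem sum_norm_sq_timeFreqLeak_le {r : ℝ} (hr : 0 ≤ r) {ι : Type*} [Fintype ι] {v : ι → L2R}
    (hv : Orthonormal ℂ v) :
    ∑ i, ‖timeFreqLeak (-r) r (v i)‖ ^ 2 ≤ 8 * Real.log (1 + 2 * r) := by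
  have h1 := (isKernelOperator_timeFreqLeak (-r) r).sum_enorm_sq_le hv
  simp_rw [enorm_sq_truncLp] at h1
  have h2 : ∫⁻ x in (Set.Icc (-r) r)ᶜ, ∫⁻ y in Set.Icc (-r) r, ‖sincKernel x y‖ₑ ^ 2
      ≤ ∫⁻ x in (Set.Icc (-r) r)ᶜ, ∫⁻ y in Set.Icc (-r) r, sincMajorant (x - y) :=
    lintegral_mono fun x => lintegral_mono fun y => enorm_sq_sincKernel_le x y
  have hswap := lintegral_lintegral_swap (μ := volume.restrict (Set.Icc (-r) r)ᶜ)
    (ν := volume.restrict (Set.Icc (-r) r)) (f := fun x y => sincMajorant (x - y))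
    measurable_sincMajorant_sub.aemeasurable
  rw [hswap] at h2
  have h3 := h1.trans (h2.trans (lintegral_lintegral_sincMajorant_le hr))
  simp_rw [enorm_sq_eq_ofReal] at h3
  rw [← ENNReal.ofReal_sum_of_nonneg fun _ _ => by positivity] at h3
  exact (ENNReal.ofReal_le_ofReal_iff
    (mul_nonneg (by norm_num) (Real.log_nonneg (by linarith)))).mp h3

theorem lintegral_enorm_sq_truncLp_expChar (a b : ℝ) :
    ∫⁻ ω in Set.Icc (-1 / 2 : ℝ) (1 / 2), ‖truncLp a b (expChar ω)‖ₑ ^ 2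
      = ENNReal.ofReal (b - a) := by
  simp_rw [enorm_sq_truncLp, enorm_sq_eq_ofReal, norm_expChar]
  simp
  norm_num

theorem hasSum_norm_sq_bandLimit_timeLimit {a b : ℝ} (hab : a ≤ b) {ι : Type*}
    (e : HilbertBasis ι ℂ L2R) :
    HasSum (fun i => ‖(bandLimit (-1 / 2) (1 / 2) ∘L timeLimit a b) (e i)‖ ^ 2) (b - a) := by
  have : Fact ((2 : ℝ≥0∞) ≠ ∞) := ⟨by norm_num⟩
  have := e.orthonormal.countable_index
  have h := (isKernelOperator_bandLimit_timeLimit a b (-1 / 2) (1 / 2)).tsum_enorm_sq_eq e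
  rw [lintegral_enorm_sq_truncLp_expChar] at h
  simp_rw [enorm_sq_eq_ofReal] at h
  have hs : Summable fun i => ‖(bandLimit (-1 / 2) (1 / 2) ∘L timeLimit a b) (e i)‖ ^ 2 := by
    have h1 := ENNReal.summable_toReal (h.trans_ne ENNReal.ofReal_ne_top)
    simpa only [ENNReal.toReal_ofReal (sq_nonneg _)] using h1
  rw [← ENNReal.ofReal_tsum_of_nonneg (fun _ => by positivity) hs] at h
  rw [ENNReal.ofReal_eq_ofReal_iff (tsum_nonneg fun _ => by positivity) (by linarith)] at h
  exact h ▸ hs.hasSum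

theorem sum_norm_sq_bandLimit_timeLimit_le {a b : ℝ} (hab : a ≤ b) {ι : Type*} [Fintype ι]
    {v : ι → L2R} (hv : Orthonormal ℂ v) :
    ∑ i, ‖(bandLimit (-1 / 2) (1 / 2) ∘L timeLimit a b) (v i)‖ ^ 2 ≤ b - a := by
  have h := (isKernelOperator_bandLimit_timeLimit a b (-1 / 2) (1 / 2)).sum_enorm_sq_le hv
  rw [lintegral_enorm_sq_truncLp_expChar] at h
  simp_rw [enorm_sq_eq_ofReal] at h
  rw [← ENNReal.ofReal_sum_of_nonneg fun _ _ => by positivity] at h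
  exact (ENNReal.ofReal_le_ofReal_iff (by linarith)).mp h

theorem isCompactOperator_timeFreqLoc {a b : ℝ} (hab : a ≤ b) :
    IsCompactOperator (timeFreqLoc a b (-1 / 2) (1 / 2)) := by
  obtain ⟨w, e, -⟩ := exists_hilbertBasis ℂ L2R
  exact (isCompactOperator_of_summable_norm_sq e _
    (hasSum_norm_sq_bandLimit_timeLimit hab e).summable).clm_comp (timeLimit a b)

end KernelBounds

/-! ### Finite-rank approximation of the leak on Whitney pieces. -/

section WhitneyPieces

open scoped InnerProductSpace ENNReal

/-- The linear functional `u ↦ ∫_{[a,b] ∩ W} φ u`. -/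
noncomputable def weightedIntegral (a b : ℝ) (W : Set ℝ) (φ : C(ℝ, ℂ)) : L2R →ₗ[ℂ] ℂ where
  toFun u := ∫ y in Set.Icc a b ∩ W, φ y * u y
  map_add' u v := by
    have h : ∀ u : L2R, IntegrableOn (fun y => φ y * u y) (Set.Icc a b ∩ W) := fun u =>
      ((integrableOn_Icc_L2 a b u).continuousOn_mul φ.continuous.continuousOn
        isCompact_Icc).mono_set Set.inter_subset_left
    rw [← integral_add (h u) (h v)]
    apply integral_congr_ae
    filter_upwards [ae_restrict_of_ae (Lp.coeFn_add u v)] with y hy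
    rw [hy, Pi.add_apply, mul_add]
  map_smul' k u := by
    rw [RingHom.id_apply, smul_eq_mul, ← integral_const_mul]
    apply integral_congr_ae
    filter_upwards [ae_restrict_of_ae (Lp.coeFn_smul k u)] with y hy
    rw [hy, Pi.smul_apply, smul_eq_mul]
    ring

theorem weightedIntegral_apply (a b : ℝ) (W : Set ℝ) (φ : C(ℝ, ℂ)) (u : L2R) :
    weightedIntegral a b W φ u = ∫ y in Set.Icc a b ∩ W, φ y * u y := rfl

/-- The weight `(y - c)^m cos(πy)` or `(y - c)^m sin(πy)`. -/
noncomputable def momentWeight (c : ℝ) (m : ℕ) (s : Bool) : C(ℝ, ℂ) :=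
  ⟨fun y => (((y - c) ^ m * if s then Real.cos (Real.pi * y) else Real.sin (Real.pi * y) : ℝ) : ℂ),
    by cases s <;> simp only [Bool.false_eq_true, if_true, if_false] <;> fun_prop⟩

/-- The first `n` terms of the expansion of `sin(π(x - y)) / (π(x - y))` in powers of
`(y - c) / (x - c)`. -/
noncomputable def sincExpansion (c : ℝ) (n : ℕ) (x : ℝ) : C(ℝ, ℂ) :=
  ⟨fun y => ((Real.sin (Real.pi * (x - y)) / Real.pi *
      ∑ m ∈ Finset.range n, (y - c) ^ m / (x - c) ^ (m + 1) : ℝ) : ℂ), by fun_prop⟩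

/-- The addition formula for `sin(π(x - y))` separates `x` from `y`: every truncated expansion,
whatever `x`, is a combination of the same `2n` weights. -/
theorem weightedIntegral_sincExpansion_eq_zero {a b c : ℝ} {W : Set ℝ} {n : ℕ} {u : L2R}
    (h : ∀ m < n, ∀ s, weightedIntegral a b W (momentWeight c m s) u = 0) (x : ℝ) :
    weightedIntegral a b W (sincExpansion c n x) u = 0 := by
  have hi : ∀ φ : C(ℝ, ℂ), IntegrableOn (fun y => φ y * u y) (Set.Icc a b ∩ W) := fun φ =>
    ((integrableOn_Icc_L2 a b u).continuousOn_mul φ.continuous.continuousOn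
      isCompact_Icc).mono_set Set.inter_subset_left
  have he : ∀ y : ℝ, sincExpansion c n x y * u y = ∑ m ∈ Finset.range n,
      ((((Real.sin (Real.pi * x) / Real.pi / (x - c) ^ (m + 1) : ℝ) : ℂ)) *
          (momentWeight c m true y * u y) -
        (((Real.cos (Real.pi * x) / Real.pi / (x - c) ^ (m + 1) : ℝ) : ℂ)) *
          (momentWeight c m false y * u y)) := by
    intro y
    simp only [sincExpansion, momentWeight, ContinuousMap.coe_mk, Finset.mul_sum,
      Complex.ofReal_sum, Finset.sum_mul, if_true, Bool.false_eq_true, if_false]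
    refine Finset.sum_congr rfl fun m _ => ?_
    rw [mul_sub, Real.sin_sub]
    push_cast
    ring
  rw [weightedIntegral_apply]
  simp_rw [he]
  rw [integral_finsetSum]
  · refine Finset.sum_eq_zero fun m hm => ?_
    have hm' := Finset.mem_range.mp hm
    rw [integral_sub ((hi _).const_mul _) ((hi _).const_mul _), integral_const_mul,
      integral_const_mul, ← weightedIntegral_apply, ← weightedIntegral_apply, h m hm', h m hm']
    simp
  · intro m _
    exact ((hi _).const_mul _).sub ((hi _).const_mul _)

theorem inv_sub_sub_geom_sum {p q : ℝ} (hp : p ≠ 0) (hpq : p - q ≠ 0) (n : ℕ) :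
    1 / (p - q) - ∑ m ∈ Finset.range n, q ^ m / p ^ (m + 1) = (q / p) ^ n / (p - q) := by
  induction n with
  | zero => simp
  | succ n ih =>
    rw [Finset.sum_range_succ, ← sub_sub, ih, div_pow, div_pow]
    field_simp
    ring

theorem sincKernel_sub_sincExpansion {c x y : ℝ} (hxc : x - c ≠ 0) (hxy : x - y ≠ 0) (n : ℕ) :
    sincKernel x y - sincExpansion c n x y
      = sincKernel x y * ((((y - c) / (x - c)) ^ n : ℝ) : ℂ) := by
  have h := inv_sub_sub_geom_sum (p := x - c) (q := y - c) hxc (by rwa [sub_sub_sub_cancel_right]) n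
  rw [sub_sub_sub_cancel_right] at h
  simp only [sincKernel, sincExpansion, ContinuousMap.coe_mk]
  rw [Real.sinc_of_ne_zero (mul_ne_zero Real.pi_ne_zero hxy), ← Complex.ofReal_sub,
    ← Complex.ofReal_mul]
  congr 1
  calc _ = Real.sin (Real.pi * (x - y)) / Real.pi *
        (1 / (x - y) - ∑ m ∈ Finset.range n, (y - c) ^ m / (x - c) ^ (m + 1)) := by
        rw [mul_sub]
        field_simp
    _ = _ := by
        rw [h]
        field_simp

theorem enorm_sq_sincKernel_sub_sincExpansion_le {c x y : ℝ} (hxc : x - c ≠ 0) (hxy : x - y ≠ 0)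
    (h : 3 * |y - c| ≤ |x - c|) (n : ℕ) :
    ‖sincKernel x y - sincExpansion c n x y‖ₑ ^ 2
      ≤ sincMajorant (x - y) * ENNReal.ofReal ((1 / 9) ^ n) := by
  rw [sincKernel_sub_sincExpansion hxc hxy, enorm_mul, mul_pow]
  refine mul_le_mul' (enorm_sq_sincKernel_le x y) ?_
  rw [enorm_sq_eq_ofReal]
  refine ENNReal.ofReal_le_ofReal ?_
  rw [Complex.norm_real, norm_pow, ← pow_mul, mul_comm n 2, pow_mul]
  refine pow_le_pow_left₀ (by positivity) ?_ n
  rw [Real.norm_eq_abs, abs_div]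
  have h1 : |y - c| / |x - c| ≤ 1 / 3 := by
    rw [div_le_div_iff₀ (abs_pos.mpr hxc) (by norm_num)]
    linarith
  calc (|y - c| / |x - c|) ^ 2 ≤ (1 / 3) ^ 2 := pow_le_pow_left₀ (by positivity) h1 2
    _ = 1 / 9 := by norm_num

theorem enorm_sq_integral_mul_le {s : Set ℝ} {f : ℝ → ℂ} (hf : AEMeasurable f (volume.restrict s))
    (u : L2R) : ‖∫ y in s, f y * u y‖ₑ ^ 2 ≤ (∫⁻ y in s, ‖f y‖ₑ ^ 2) * ‖u‖ₑ ^ 2 := by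
  have hu : AEMeasurable (fun y => ‖u y‖ₑ) (volume.restrict s) :=
    (Lp.aestronglyMeasurable u).aemeasurable.enorm.restrict
  have h1 : ‖∫ y in s, f y * u y‖ₑ ≤ ∫⁻ y in s, ‖f y‖ₑ * ‖u y‖ₑ := by
    refine (enorm_integral_le_lintegral_enorm _).trans (le_of_eq ?_)
    simp_rw [enorm_mul]
  have h2 := ENNReal.lintegral_mul_le_Lp_mul_Lq (volume.restrict s) Real.HolderConjugate.two_two
    hf.enorm hu
  have h3 := pow_le_pow_left' (h1.trans h2) 2
  refine h3.trans ?_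
  have hsq : ∀ z : ℝ≥0∞, (z ^ (1 / 2 : ℝ)) ^ 2 = z := fun z => by
    rw [← ENNReal.rpow_natCast, ← ENNReal.rpow_mul]
    norm_num
  rw [mul_pow, hsq, hsq, enorm_sq_L2_eq_lintegral]
  simp only [ENNReal.rpow_two]
  exact mul_le_mul_right (setLIntegral_le_lintegral _ _) _

/-- The sign `1` for `true` and `-1` for `false`. -/
def boolSign (σ : Bool) : ℝ := if σ then 1 else -1

/-- The part of `[-r, r]` on the side `σ` whose distance to `{-r, r}` lies in
`(r 2^{-j-1}, r 2^{-j}]`. -/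
def whitneyPiece (r : ℝ) (σ : Bool) (j : ℕ) : Set ℝ :=
  {y | (0 ≤ y ↔ σ = true) ∧ r * (1 / 2) ^ (j + 1) < r - |y| ∧ r - |y| ≤ r * (1 / 2) ^ j}

/-- The midpoint of a Whitney piece. -/
noncomputable def whitneyCenter (r : ℝ) (σ : Bool) (j : ℕ) : ℝ :=
  boolSign σ * (r - 3 / 4 * (r * (1 / 2) ^ j))

theorem measurableSet_whitneyPiece (r : ℝ) (σ : Bool) (j : ℕ) :
    MeasurableSet (whitneyPiece r σ j) := by
  have h : whitneyPiece r σ j = {y : ℝ | 0 ≤ y ↔ σ = true} ∩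
      ({y : ℝ | r * (1 / 2) ^ (j + 1) < r - |y|} ∩ {y : ℝ | r - |y| ≤ r * (1 / 2) ^ j}) := rfl
  rw [h]
  refine MeasurableSet.inter ?_ ((measurableSet_lt (by fun_prop) (by fun_prop)).inter
    (measurableSet_le (by fun_prop) (by fun_prop)))
  cases σ
  · have : {y : ℝ | 0 ≤ y ↔ false = true} = Set.Iio 0 := by ext y; simp
    rw [this]
    exact measurableSet_Iio
  · have : {y : ℝ | 0 ≤ y ↔ true = true} = Set.Ici 0 := by ext y; simp
    rw [this]
    exact measurableSet_Ici

theorem eq_of_mem_whitneyPiece {r : ℝ} (hr : 0 < r) {σ σ' : Bool} {j j' : ℕ} {y : ℝ}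
    (h : y ∈ whitneyPiece r σ j) (h' : y ∈ whitneyPiece r σ' j') : σ = σ' ∧ j = j' := by
  obtain ⟨h1, h2, h3⟩ := h
  obtain ⟨h1', h2', h3'⟩ := h'
  refine ⟨Bool.eq_iff_iff.mpr (h1.symm.trans h1'), ?_⟩
  have key : ∀ {i k : ℕ}, r * (1 / 2) ^ (i + 1) < r - |y| → r - |y| ≤ r * (1 / 2) ^ k → k ≤ i := by
    intro i k hi hk
    by_contra! hlt
    have h4 : (1 / 2 : ℝ) ^ k ≤ (1 / 2) ^ (i + 1) :=
      pow_le_pow_of_le_one (by norm_num) (by norm_num) hlt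
    nlinarith
  exact le_antisymm (key h2' h3) (key h2 h3')

theorem exists_mem_whitneyPiece {r y : ℝ} {M : ℕ} (hy : r * (1 / 2) ^ M < r - |y|) :
    ∃ (σ : Bool) (j : Fin M), y ∈ whitneyPiece r σ j := by
  have hex : ∃ j, r * (1 / 2) ^ j < r - |y| := ⟨M, hy⟩
  classical
  have h0 : Nat.find hex ≠ 0 := by
    intro h
    have := Nat.find_spec hex
    rw [h] at this
    have := abs_nonneg y
    linarith
  obtain ⟨k, hk⟩ := Nat.exists_eq_succ_of_ne_zero h0
  have hkM : k < M := by
    have := Nat.find_min' hex hy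
    omega
  refine ⟨decide (0 ≤ y), ⟨k, hkM⟩, by simp, ?_, ?_⟩
  · have := Nat.find_spec hex
    rwa [hk] at this
  · have := Nat.find_min hex (m := k) (by omega)
    exact not_lt.mp this

/-- With `t = r 2⁻ʲ`, the piece has half-width `t/4` and its centre lies `3t/4` from the nearer
endpoint, hence at least that far from any outside point. -/
theorem three_mul_abs_sub_whitneyCenter_le {r x y : ℝ} (hr : 0 < r) {σ : Bool} {j : ℕ}
    (hy : y ∈ whitneyPiece r σ j) (hx : r < |x|) :
    3 * |y - whitneyCenter r σ j| ≤ |x - whitneyCenter r σ j| ∧ x - whitneyCenter r σ j ≠ 0 := by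
  obtain ⟨h1, h2, h3⟩ := hy
  have hp : 0 < r * (1 / 2 : ℝ) ^ j := by positivity
  have hp1 : r * (1 / 2 : ℝ) ^ j ≤ r := by
    have : (1 / 2 : ℝ) ^ j ≤ 1 := pow_le_one₀ (by norm_num) (by norm_num)
    nlinarith
  rw [pow_succ, ← mul_assoc] at h2
  rw [whitneyCenter]
  generalize r * (1 / 2 : ℝ) ^ j = t at *
  have h2' : t / 2 < r - |y| := by linarith
  cases σ
  · have hy0 : y < 0 := by simpa using h1
    rw [abs_of_neg hy0] at h2' h3
    have e : boolSign false = -1 := rfl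
    rw [e]
    have ha : |y - -1 * (r - 3 / 4 * t)| ≤ t / 4 := by
      rw [abs_le]
      constructor <;> linarith
    have hb : 3 / 4 * t < |x - -1 * (r - 3 / 4 * t)| := by
      rw [lt_abs] at hx ⊢
      rcases hx with hx | hx
      · left; linarith
      · right; linarith
    exact ⟨by linarith, abs_pos.mp (by linarith)⟩
  · have hy0 : 0 ≤ y := by simpa using h1
    rw [abs_of_nonneg hy0] at h2' h3
    have e : boolSign true = 1 := rfl
    rw [e]
    have ha : |y - 1 * (r - 3 / 4 * t)| ≤ t / 4 := by
      rw [abs_le]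
      constructor <;> linarith
    have hb : 3 / 4 * t < |x - 1 * (r - 3 / 4 * t)| := by
      rw [lt_abs] at hx ⊢
      rcases hx with hx | hx
      · left; linarith
      · right; linarith
    exact ⟨by linarith, abs_pos.mp (by linarith)⟩

/-- The finite-rank approximation of the kernel `sincKernel x` on the Whitney pieces of
`[-r, r]`. -/
noncomputable def sincApprox (r : ℝ) (M n : ℕ) (x y : ℝ) : ℂ :=
  ∑ p : Bool × Fin M, (whitneyPiece r p.1 p.2).indicator
    (sincExpansion (whitneyCenter r p.1 p.2) n x) y

/-- The points within `r 2^{-M}` of the boundary of `[-r, r]`, or outside of it. -/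
def edgeZone (r : ℝ) (M : ℕ) : Set ℝ := {y | r - |y| ≤ r * (1 / 2) ^ M}

theorem measurableSet_edgeZone (r : ℝ) (M : ℕ) : MeasurableSet (edgeZone r M) :=
  measurableSet_le (by fun_prop) (by fun_prop)

theorem measurable_sincApprox (r : ℝ) (M n : ℕ) (x : ℝ) : Measurable (sincApprox r M n x) := by
  unfold sincApprox
  exact Finset.measurable_fun_sum _ fun p _ =>
    (ContinuousMap.measurable _).indicator (measurableSet_whitneyPiece r p.1 p.2)

/-- Either `y` lies in exactly one piece, where the geometric remainder applies, or it lies in the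
edge zone, where the approximation is zero and the kernel itself is the error. -/
theorem enorm_sq_sincKernel_sub_sincApprox_le {r x y : ℝ} (hr : 0 < r) (hx : r < |x|)
    (hy : |y| ≤ r) (M n : ℕ) :
    ‖sincKernel x y - sincApprox r M n x y‖ₑ ^ 2
      ≤ sincMajorant (x - y) *
        (ENNReal.ofReal ((1 / 9) ^ n) + (edgeZone r M).indicator 1 y) := by
  have hxy : x - y ≠ 0 := by
    intro h
    rw [sub_eq_zero.mp h] at hx
    linarith
  by_cases hp : ∃ p : Bool × Fin M, y ∈ whitneyPiece r p.1 p.2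
  · obtain ⟨p, hp⟩ := hp
    have h1 : sincApprox r M n x y = sincExpansion (whitneyCenter r p.1 p.2) n x y := by
      rw [sincApprox, Finset.sum_eq_single p]
      · rw [Set.indicator_of_mem hp]
      · intro q _ hqp
        refine Set.indicator_of_notMem (fun hq => hqp ?_) _
        obtain ⟨h2, h3⟩ := eq_of_mem_whitneyPiece hr hq hp
        exact Prod.ext h2 (Fin.ext h3)
      · exact fun h => (h (Finset.mem_univ p)).elim
    obtain ⟨h2, h3⟩ := three_mul_abs_sub_whitneyCenter_le hr hp hx
    rw [h1]
    refine (enorm_sq_sincKernel_sub_sincExpansion_le h3 hxy h2 n).trans ?_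
    gcongr
    exact le_self_add
  · have h1 : sincApprox r M n x y = 0 :=
      Finset.sum_eq_zero fun p _ => Set.indicator_of_notMem (fun h => hp ⟨p, h⟩) _
    have h2 : y ∈ edgeZone r M := by
      by_contra h
      obtain ⟨σ, j, hj⟩ := exists_mem_whitneyPiece (not_le.mp h)
      exact hp ⟨(σ, j), hj⟩
    rw [h1, sub_zero, Set.indicator_of_mem h2]
    refine (enorm_sq_sincKernel_le x y).trans ?_
    conv_lhs => rw [← mul_one (sincMajorant (x - y))]
    gcongr
    exact le_add_self

theorem integral_sincApprox_mul_eq_zero {r : ℝ} {M n : ℕ} {u : L2R}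
    (h : ∀ (p : Bool × Fin M) (m : Fin n) (s : Bool), weightedIntegral (-r) r
      (whitneyPiece r p.1 p.2) (momentWeight (whitneyCenter r p.1 p.2) m s) u = 0) (x : ℝ) :
    IntegrableOn (fun y => sincApprox r M n x y * u y) (Set.Icc (-r) r) ∧
      ∫ y in Set.Icc (-r) r, sincApprox r M n x y * u y = 0 := by
  have hi : ∀ φ : C(ℝ, ℂ), IntegrableOn (fun y => φ y * u y) (Set.Icc (-r) r) := fun φ =>
    (integrableOn_Icc_L2 (-r) r u).continuousOn_mul φ.continuous.continuousOn isCompact_Icc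
  have he : ∀ y, sincApprox r M n x y * u y = ∑ p : Bool × Fin M,
      (whitneyPiece r p.1 p.2).indicator
        (fun y => sincExpansion (whitneyCenter r p.1 p.2) n x y * u y) y := by
    intro y
    rw [sincApprox, Finset.sum_mul]
    refine Finset.sum_congr rfl fun p _ => ?_
    by_cases hy : y ∈ whitneyPiece r p.1 p.2
    · rw [Set.indicator_of_mem hy, Set.indicator_of_mem hy]
    · rw [Set.indicator_of_notMem hy, Set.indicator_of_notMem hy, zero_mul]
  have hi' : ∀ p : Bool × Fin M, IntegrableOn ((whitneyPiece r p.1 p.2).indicator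
      (fun y => sincExpansion (whitneyCenter r p.1 p.2) n x y * u y)) (Set.Icc (-r) r) :=
    fun p => (hi _).indicator (measurableSet_whitneyPiece r p.1 p.2)
  simp_rw [he]
  refine ⟨integrable_finsetSum _ fun p _ => hi' p, ?_⟩
  rw [integral_finsetSum _ fun p _ => hi' p]
  refine Finset.sum_eq_zero fun p _ => ?_
  rw [setIntegral_indicator (measurableSet_whitneyPiece r p.1 p.2), ← weightedIntegral_apply]
  exact weightedIntegral_sincExpansion_eq_zero (fun m hm s => h p ⟨m, hm⟩ s) x

/-- The moment conditions allow the approximation to be subtracted from the kernel for free;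
Cauchy–Schwarz does the rest. -/
theorem enorm_sq_inner_truncLp_sincKernel_le {r x : ℝ} (hr : 0 < r) (hx : r < |x|) {M n : ℕ}
    {u : L2R} (h : ∀ (p : Bool × Fin M) (m : Fin n) (s : Bool), weightedIntegral (-r) r
      (whitneyPiece r p.1 p.2) (momentWeight (whitneyCenter r p.1 p.2) m s) u = 0) :
    ‖⟪truncLp (-r) r (sincKernel x), u⟫_ℂ‖ₑ ^ 2
      ≤ (∫⁻ y in Set.Icc (-r) r, sincMajorant (x - y) *
        (ENNReal.ofReal ((1 / 9) ^ n) + (edgeZone r M).indicator 1 y)) * ‖u‖ₑ ^ 2 := by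
  obtain ⟨h1, h2⟩ := integral_sincApprox_mul_eq_zero h x
  have h3 : ⟪truncLp (-r) r (sincKernel x), u⟫_ℂ
      = ∫ y in Set.Icc (-r) r, (sincKernel x y - sincApprox r M n x y) * u y := by
    have hi : IntegrableOn (fun y => sincKernel x y * u y) (Set.Icc (-r) r) :=
      (integrableOn_Icc_L2 (-r) r u).continuousOn_mul (sincKernel x).continuous.continuousOn
        isCompact_Icc
    simp_rw [sub_mul]
    rw [integral_sub hi h1, h2, sub_zero, inner_truncLp]
    simp_rw [sincKernel_apply, Complex.conj_ofReal]
  rw [h3]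
  refine (enorm_sq_integral_mul_le ?_ u).trans ?_
  · exact ((sincKernel x).measurable.sub (measurable_sincApprox r M n x)).aemeasurable
  · refine mul_le_mul' (setLIntegral_mono' measurableSet_Icc fun y hy => ?_) le_rfl
    exact enorm_sq_sincKernel_sub_sincApprox_le hr hx (abs_le.mpr hy) M n

theorem volume_edgeZone_inter_le {r : ℝ} (hr : 0 < r) (M : ℕ) :
    volume (edgeZone r M ∩ Set.Icc (-r) r) ≤ ENNReal.ofReal (2 * (r * (1 / 2) ^ M)) := by
  set t := r * (1 / 2 : ℝ) ^ M with ht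
  have ht0 : 0 ≤ t := by positivity
  have hsub : edgeZone r M ∩ Set.Icc (-r) r ⊆ Set.Icc (-r) (-r + t) ∪ Set.Icc (r - t) r := by
    rintro y ⟨hy, hy1, hy2⟩
    have hy' : r - |y| ≤ t := hy
    rcases le_total 0 y with h0 | h0
    · rw [abs_of_nonneg h0] at hy'
      exact Or.inr ⟨by linarith, hy2⟩
    · rw [abs_of_nonpos h0] at hy'
      exact Or.inl ⟨hy1, by linarith⟩
  refine (measure_mono hsub).trans ((measure_union_le _ _).trans (le_of_eq ?_))
  rw [Real.volume_Icc, Real.volume_Icc, ← ENNReal.ofReal_add (by linarith) (by linarith)]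
  congr 1
  ring

theorem lintegral_sincMajorant_mul_weight_le {r : ℝ} (hr : 0 < r) (M n : ℕ) :
    ∫⁻ x in (Set.Icc (-r) r)ᶜ, ∫⁻ y in Set.Icc (-r) r, sincMajorant (x - y) *
        (ENNReal.ofReal ((1 / 9) ^ n) + (edgeZone r M).indicator 1 y)
      ≤ ENNReal.ofReal ((1 / 9) ^ n * (8 * Real.log (1 + 2 * r)) + 16 * (r * (1 / 2) ^ M)) := by
  have hm : Measurable (fun y : ℝ =>
      (ENNReal.ofReal ((1 / 9) ^ n) + (edgeZone r M).indicator (1 : ℝ → ℝ≥0∞) y)) :=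
    (measurable_one.indicator (measurableSet_edgeZone r M)).const_add _
  have hswap := lintegral_lintegral_swap (μ := volume.restrict (Set.Icc (-r) r)ᶜ)
    (ν := volume.restrict (Set.Icc (-r) r)) (f := fun x y => sincMajorant (x - y) *
        (ENNReal.ofReal ((1 / 9) ^ n) + (edgeZone r M).indicator 1 y))
    (measurable_sincMajorant_sub.mul (hm.comp measurable_snd)).aemeasurable
  rw [hswap]
  have hmx : ∀ y, Measurable (fun x => sincMajorant (x - y)) := fun y =>
    measurable_sincMajorant.comp (by fun_prop)
  simp_rw [fun y => lintegral_mul_const (μ := volume.restrict (Set.Icc (-r) r)ᶜ)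
    (ENNReal.ofReal ((1 / 9) ^ n) + (edgeZone r M).indicator (1 : ℝ → ℝ≥0∞) y) (hmx y), mul_add]
  have hmy : Measurable fun y => ∫⁻ x in (Set.Icc (-r) r)ᶜ, sincMajorant (x - y) :=
    Measurable.lintegral_prod_left' measurable_sincMajorant_sub
  rw [lintegral_add_left (hmy.mul_const _), lintegral_mul_const _ hmy,
    ENNReal.ofReal_add (mul_nonneg (by positivity)
      (mul_nonneg (by norm_num) (Real.log_nonneg (by linarith)))) (by positivity)]
  refine add_le_add ?_ ?_
  · rw [mul_comm, ENNReal.ofReal_mul (by positivity)]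
    gcongr
    exact lintegral_lintegral_sincMajorant_le hr.le
  -- On the edge zone the inner integral is at most `8` uniformly, and the zone has measure at most
  -- `2 r 2⁻ᴹ` inside the interval.
  · calc ∫⁻ y in Set.Icc (-r) r, (∫⁻ x in (Set.Icc (-r) r)ᶜ, sincMajorant (x - y)) *
          (edgeZone r M).indicator 1 y
        ≤ ∫⁻ y in Set.Icc (-r) r, 8 * (edgeZone r M).indicator 1 y := by
          gcongr with y
          exact (setLIntegral_le_lintegral _ _).trans (lintegral_sincMajorant_le y)
      _ = 8 * volume (edgeZone r M ∩ Set.Icc (-r) r) := by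
          rw [lintegral_const_mul _ (measurable_one.indicator (measurableSet_edgeZone r M)),
            lintegral_indicator_one (measurableSet_edgeZone r M),
            Measure.restrict_apply (measurableSet_edgeZone r M)]
      _ ≤ 8 * ENNReal.ofReal (2 * (r * (1 / 2) ^ M)) := by
          gcongr
          exact volume_edgeZone_inter_le hr M
      _ = _ := by
          have : (8 : ℝ≥0∞) = ENNReal.ofReal 8 := by norm_num
          rw [this, ← ENNReal.ofReal_mul (by norm_num)]
          congr 1
          ring

theorem norm_sq_timeFreqLeak_le {r : ℝ} (hr : 0 < r) {M n : ℕ} {u : L2R}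
    (h : ∀ (p : Bool × Fin M) (m : Fin n) (s : Bool), weightedIntegral (-r) r
      (whitneyPiece r p.1 p.2) (momentWeight (whitneyCenter r p.1 p.2) m s) u = 0) :
    ‖timeFreqLeak (-r) r u‖ ^ 2
      ≤ ((1 / 9) ^ n * (8 * Real.log (1 + 2 * r)) + 16 * (r * (1 / 2) ^ M)) * ‖u‖ ^ 2 := by
  have hlog : 0 ≤ Real.log (1 + 2 * r) := Real.log_nonneg (by linarith)
  have h1 : ‖timeFreqLeak (-r) r u‖ₑ ^ 2 ≤ ENNReal.ofReal
      ((1 / 9) ^ n * (8 * Real.log (1 + 2 * r)) + 16 * (r * (1 / 2) ^ M)) * ‖u‖ₑ ^ 2 := by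
    rw [(isKernelOperator_timeFreqLeak (-r) r u).2]
    calc _ ≤ ∫⁻ x in (Set.Icc (-r) r)ᶜ, (∫⁻ y in Set.Icc (-r) r, sincMajorant (x - y) *
        (ENNReal.ofReal ((1 / 9) ^ n) + (edgeZone r M).indicator 1 y)) * ‖u‖ₑ ^ 2 := by
          refine setLIntegral_mono' measurableSet_Icc.compl fun x hx => ?_
          refine enorm_sq_inner_truncLp_sincKernel_le hr ?_ h
          by_contra hc
          exact hx (abs_le.mp (not_lt.mp hc))
      _ ≤ _ := by
          rw [lintegral_mul_const' _ _ (by simp)]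
          gcongr
          exact lintegral_sincMajorant_mul_weight_le hr M n
  rw [enorm_sq_eq_ofReal, enorm_sq_eq_ofReal, ← ENNReal.ofReal_mul (by positivity)] at h1
  exact (ENNReal.ofReal_le_ofReal_iff (by positivity)).mp h1

end WhitneyPieces

/-! ### Counting eigenvalues and locating the plunge indices. -/

section EigenvalueCount

open scoped InnerProductSpace

variable {r ε : ℝ} {M n : ℕ}

theorem norm_sq_timeFreqLeak_sum_eigenvectors {ι : Type*} [Fintype ι] {v : ι → L2R} {ν : ι → ℝ}
    {a b : ℝ} (hv : Orthonormal ℂ v)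
    (hν : ∀ i, timeFreqLoc a b (-1 / 2) (1 / 2) (v i) = (ν i : ℂ) • v i) (c : ι → ℂ) :
    ‖timeFreqLeak a b (∑ i, c i • v i)‖ ^ 2 = ∑ i, ‖c i‖ ^ 2 * (ν i * (1 - ν i)) :=
  norm_sq_sub_comp_sum_eigenvectors (isSymmetric_timeLimit a b) (isSymmetric_bandLimit _ _)
    (timeLimit_timeLimit a b) (bandLimit_bandLimit _ _) hv hν c

theorem norm_sq_timeFreqLeak_eigenvector {ι : Type*} [Fintype ι] {v : ι → L2R} {ν : ι → ℝ}
    {a b : ℝ} (hv : Orthonormal ℂ v)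
    (hν : ∀ i, timeFreqLoc a b (-1 / 2) (1 / 2) (v i) = (ν i : ℂ) • v i) (i : ι) :
    ‖timeFreqLeak a b (v i)‖ ^ 2 = ν i * (1 - ν i) := by
  classical
  have h := norm_sq_timeFreqLeak_sum_eigenvectors hv hν (Pi.single i 1)
  simpa [Pi.single_apply, apply_ite, ite_pow] using h

theorem norm_sq_bandLimit_timeLimit_eigenvector {ι : Type*} [Fintype ι] {v : ι → L2R}
    {ν : ι → ℝ} {a b : ℝ} (hv : Orthonormal ℂ v)
    (hν : ∀ i, timeFreqLoc a b (-1 / 2) (1 / 2) (v i) = (ν i : ℂ) • v i) (i : ι) :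
    ‖(bandLimit (-1 / 2) (1 / 2) ∘L timeLimit a b) (v i)‖ ^ 2 = ν i := by
  classical
  have h := norm_sq_comp_sum_eigenvectors (isSymmetric_timeLimit a b)
    (isSymmetric_bandLimit (-1 / 2) (1 / 2)) (bandLimit_bandLimit _ _) hv hν (Pi.single i 1)
  simpa [Pi.single_apply, apply_ite, ite_pow] using h

/-- The number of eigenvalues in the plunge region `(ε, 1 - ε)`. -/
theorem card_le_of_eigenvalues_mem_Ioo (hr : 0 < r) (hε : 0 < ε) (hε2 : ε < 1 / 2)
    (hκ : (1 / 9) ^ n * (8 * Real.log (1 + 2 * r)) + 16 * (r * (1 / 2) ^ M) ≤ ε / 2)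
    {ι : Type*} [Fintype ι] {v : ι → L2R} {ν : ι → ℝ} (hv : Orthonormal ℂ v)
    (hν : ∀ i, timeFreqLoc (-r) r (-1 / 2) (1 / 2) (v i) = (ν i : ℂ) • v i)
    (hmem : ∀ i, ν i ∈ Set.Ioo ε (1 - ε)) : Fintype.card ι ≤ 4 * M * n := by
  by_contra! hlt
  -- With more eigenvectors than the `4Mn` moment functionals, some nonzero combination satisfies
  -- every moment condition. Its leak is then too small for eigenvalues in `(ε, 1 - ε)`.
  let f : (ι → ℂ) →ₗ[ℂ] ((Bool × Fin M) × Fin n × Bool → ℂ) :=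
    LinearMap.pi fun q => (weightedIntegral (-r) r (whitneyPiece r q.1.1 q.1.2)
      (momentWeight (whitneyCenter r q.1.1 q.1.2) q.2.1 q.2.2)) ∘ₗ Fintype.linearCombination ℂ v
  have hker : LinearMap.ker f ≠ ⊥ := by
    apply LinearMap.ker_ne_bot_of_finrank_lt
    rw [Module.finrank_fintype_fun_eq_card, Module.finrank_fintype_fun_eq_card]
    simp only [Fintype.card_prod, Fintype.card_bool, Fintype.card_fin]
    calc 2 * M * (n * 2) = 4 * M * n := by ring
      _ < Fintype.card ι := hlt
  obtain ⟨c, hc, hc0⟩ := Submodule.exists_mem_ne_zero_of_ne_bot hker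
  have hzero : ∀ (p : Bool × Fin M) (m : Fin n) (s : Bool), weightedIntegral (-r) r
      (whitneyPiece r p.1 p.2) (momentWeight (whitneyCenter r p.1 p.2) m s)
      (∑ i, c i • v i) = 0 := fun p m s => congrFun (LinearMap.mem_ker.mp hc) (p, m, s)
  have h1 := norm_sq_timeFreqLeak_le hr hzero
  rw [norm_sq_timeFreqLeak_sum_eigenvectors hv hν, hv.norm_sq_sum] at h1
  have h2 : ∑ i, ‖c i‖ ^ 2 * (ε / 2) < ∑ i, ‖c i‖ ^ 2 * (ν i * (1 - ν i)) := by
    have hgt : ∀ i, ε / 2 < ν i * (1 - ν i) := fun i => by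
      obtain ⟨ha, hb⟩ := hmem i
      nlinarith
    obtain ⟨i, hi⟩ := Function.ne_iff.mp hc0
    refine Finset.sum_lt_sum (fun j _ => by gcongr; exact (hgt j).le) ⟨i, Finset.mem_univ i, ?_⟩
    have : 0 < ‖c i‖ := norm_pos_iff.mpr hi
    gcongr
    exact hgt i
  rw [← Finset.sum_mul] at h2
  have h3 : (0 : ℝ) ≤ ∑ i, ‖c i‖ ^ 2 := Finset.sum_nonneg fun _ _ => by positivity
  nlinarith

theorem sum_ite_one_le_of_eigenvalues_mem_Ioo (hr : 0 < r) (hε : 0 < ε) (hε2 : ε < 1 / 2)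
    (hκ : (1 / 9) ^ n * (8 * Real.log (1 + 2 * r)) + 16 * (r * (1 / 2) ^ M) ≤ ε / 2)
    {ι : Type*} [Fintype ι] {v : ι → L2R} {ν : ι → ℝ} (hv : Orthonormal ℂ v)
    (hν : ∀ i, timeFreqLoc (-r) r (-1 / 2) (1 / 2) (v i) = (ν i : ℂ) • v i) :
    ∑ i, (Set.Ioo ε (1 - ε)).indicator (1 : ℝ → ℝ) (ν i) ≤ 4 * M * n := by
  classical
  have h := card_le_of_eigenvalues_mem_Ioo (ι := {i // ν i ∈ Set.Ioo ε (1 - ε)})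
    (v := fun i => v i) (ν := fun i => ν i) hr hε hε2 hκ (hv.comp _ Subtype.val_injective) (fun i => hν i) (fun i => i.2)
  rw [Fintype.card_subtype] at h
  simp only [Set.indicator_apply, Pi.one_apply, Finset.sum_boole]
  exact_mod_cast h

theorem card_le_of_eigenvalues_gt (hr : 0 < r) (hε : 0 < ε) (hε2 : ε < 1 / 2)
    (hκ : (1 / 9) ^ n * (8 * Real.log (1 + 2 * r)) + 16 * (r * (1 / 2) ^ M) ≤ ε / 2)
    {ι : Type*} [Fintype ι] {v : ι → L2R} {ν : ι → ℝ} (hv : Orthonormal ℂ v)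
    (hν : ∀ i, timeFreqLoc (-r) r (-1 / 2) (1 / 2) (v i) = (ν i : ℂ) • v i)
    (hgt : ∀ i, ε < ν i) :
    (Fintype.card ι : ℝ) ≤ 2 * r + 4 * M * n + 16 * Real.log (1 + 2 * r) := by
  have h1 := sum_norm_sq_timeFreqLeak_le hr.le hv
  have h2 := sum_norm_sq_bandLimit_timeLimit_le (by linarith : -r ≤ r) hv
  have h3 := sum_ite_one_le_of_eigenvalues_mem_Ioo hr hε hε2 hκ hv hν
  simp_rw [norm_sq_bandLimit_timeLimit_eigenvector hv hν] at h2
  -- If `ν ≥ 1 - ε`, then `ν > 1/2`, so the defect `1 - ν` is at most `2ν(1 - ν)`, twice the squared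
  -- leak.
  have hpt : ∀ i, 1 ≤ ν i + (Set.Ioo ε (1 - ε)).indicator (1 : ℝ → ℝ) (ν i)
      + 2 * ‖timeFreqLeak (-r) r (v i)‖ ^ 2 := by
    intro i
    have h0 := sq_nonneg ‖timeFreqLeak (-r) r (v i)‖
    have h4 := norm_sq_timeFreqLeak_eigenvector hv hν i
    have h5 := hgt i
    by_cases h : ν i < 1 - ε
    · rw [Set.indicator_of_mem (show ν i ∈ Set.Ioo ε (1 - ε) from ⟨h5, h⟩), Pi.one_apply]
      linarith
    · rw [Set.indicator_of_notMem fun hm => h hm.2]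
      rw [h4] at h0 ⊢
      nlinarith [nonneg_of_mul_nonneg_right h0 (by linarith)]
  have h6 : (Fintype.card ι : ℝ) ≤ ∑ i, (ν i + (Set.Ioo ε (1 - ε)).indicator (1 : ℝ → ℝ) (ν i)
      + 2 * ‖timeFreqLeak (-r) r (v i)‖ ^ 2) := by
    calc (Fintype.card ι : ℝ) = ∑ _i : ι, (1 : ℝ) := by simp
      _ ≤ _ := Finset.sum_le_sum fun i _ => hpt i
  rw [Finset.sum_add_distrib, Finset.sum_add_distrib, ← Finset.mul_sum] at h6
  linarith

/-- The hypothesis `hk` says that fewer than `k` eigenvalues are at least `1 - ε`. The trace `2r`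
must then come mostly from these and the plunge region, since the small eigenvalues carry little of
it. -/
theorem two_mul_le_of_forall_not_orthonormal (hr : 0 < r) (hε : 0 < ε) (hε2 : ε < 1 / 2)
    (hκ : (1 / 9) ^ n * (8 * Real.log (1 + 2 * r)) + 16 * (r * (1 / 2) ^ M) ≤ ε / 2) {k : ℕ}
    (hk : ∀ v : Fin k → L2R, Orthonormal ℂ v → ∃ i, ∀ ν : ℝ, 1 - ε ≤ ν →
      timeFreqLoc (-r) r (-1 / 2) (1 / 2) (v i) ≠ (ν : ℂ) • v i) :
    2 * r ≤ k + 4 * M * n + 16 * Real.log (1 + 2 * r) := by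
  classical
  obtain ⟨ι, e, he⟩ := exists_hilbertBasis_eigenvectors
    (isCompactOperator_timeFreqLoc (by linarith : -r ≤ r))
    (isSymmetric_comp_comp (isSymmetric_timeLimit (-r) r) (isSymmetric_bandLimit (-1 / 2) (1 / 2)))
  set ν : ι → ℝ := fun i => ‖(bandLimit (-1 / 2) (1 / 2) ∘L timeLimit (-r) r) (e i)‖ ^ 2 with hνdef
  have hν : ∀ i, timeFreqLoc (-r) r (-1 / 2) (1 / 2) (e i) = (ν i : ℂ) • e i := by
    intro i
    obtain ⟨μ, hμ⟩ := he i
    have h1 := inner_comp_comp_self (isSymmetric_timeLimit (-r) r)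
      (isSymmetric_bandLimit (-1 / 2) (1 / 2)) (bandLimit_bandLimit _ _) (e i)
    have h2 : timeFreqLoc (-r) r (-1 / 2) (1 / 2) (e i) = μ • e i := hμ
    have h3 : ⟪timeFreqLoc (-r) r (-1 / 2) (1 / 2) (e i), e i⟫_ℂ = (ν i : ℂ) := h1
    rw [h2, inner_smul_left, inner_self_eq_norm_sq_to_K, e.orthonormal.1 i] at h3
    have h4 : μ = (ν i : ℂ) := by
      rw [← Complex.conj_conj μ, ← Complex.conj_ofReal (ν i), ← h3]
      simp
    rw [h2, h4]
  have hsum := hasSum_norm_sq_bandLimit_timeLimit (by linarith : -r ≤ r) e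
  rw [sub_neg_eq_add, ← two_mul] at hsum
  -- The trace is a sum over the whole eigenbasis, so it suffices to bound every finite partial sum
  -- uniformly.
  refine hasSum_le_of_sum_le hsum fun s => ?_
  have hvs : Orthonormal ℂ (fun i : s => e i) := e.orthonormal.comp _ Subtype.val_injective
  have hνs : ∀ i : s, timeFreqLoc (-r) r (-1 / 2) (1 / 2) (e i) = (ν i : ℂ) • e i := fun i => hν i
  have h1 := sum_norm_sq_timeFreqLeak_le hr.le hvs
  have h3 := sum_ite_one_le_of_eigenvalues_mem_Ioo hr hε hε2 hκ hvs hνs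
  have h7 : ∑ i : s, (Set.Ici (1 - ε)).indicator (1 : ℝ → ℝ) (ν i) ≤ k := by
    simp only [Set.indicator_apply, Pi.one_apply, Finset.sum_boole]
    rw [← Fintype.card_subtype]
    by_contra! hlt
    obtain ⟨φ⟩ := Function.Embedding.nonempty_of_card_le
      (α := Fin k) (β := {i : s // ν i ∈ Set.Ici (1 - ε)})
      (by rw [Fintype.card_fin]; exact_mod_cast hlt.le)
    obtain ⟨i, hi⟩ := hk (fun j => e (φ j).1)
      (hvs.comp (fun j => (φ j).1) (Subtype.val_injective.comp φ.injective))
    exact hi (ν (φ i).1) (φ i).2 (hν _)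
  -- The remaining case is `ν ≤ ε < 1/2`, where `ν ≤ 2ν(1 - ν)`.
  have hpt : ∀ i : s, ν i ≤ (Set.Ici (1 - ε)).indicator (1 : ℝ → ℝ) (ν i)
      + (Set.Ioo ε (1 - ε)).indicator (1 : ℝ → ℝ) (ν i)
      + 2 * ‖timeFreqLeak (-r) r (e i)‖ ^ 2 := by
    intro i
    have h0 := sq_nonneg ‖timeFreqLeak (-r) r (e i)‖
    have h4 := norm_sq_timeFreqLeak_eigenvector hvs hνs i
    have h5 : 0 ≤ ν i := sq_nonneg _
    have h6 : ν i ≤ 1 := by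
      by_contra! h
      rw [h4] at h0
      nlinarith
    have hnn : ∀ (A : Set ℝ) (x : ℝ), 0 ≤ A.indicator (1 : ℝ → ℝ) x := fun A x =>
      Set.indicator_nonneg (fun _ _ => zero_le_one) x
    have hn1 := hnn (Set.Ici (1 - ε)) (ν i)
    have hn2 := hnn (Set.Ioo ε (1 - ε)) (ν i)
    rcases le_or_gt (1 - ε) (ν i) with h | h
    · rw [Set.indicator_of_mem (Set.mem_Ici.mpr h), Pi.one_apply]
      linarith
    rcases lt_or_ge ε (ν i) with h' | h'
    · rw [Set.indicator_of_mem (show ν i ∈ Set.Ioo ε (1 - ε) from ⟨h', h⟩), Pi.one_apply]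
      linarith
    · rw [h4]
      nlinarith
  have h8 := Finset.sum_le_sum fun (i : s) (_ : i ∈ Finset.univ) => hpt i
  rw [Finset.sum_add_distrib, Finset.sum_add_distrib, ← Finset.mul_sum] at h8
  have h9 : ∑ i ∈ s, ν i = ∑ i : s, ν i := (Finset.sum_coe_sort s ν).symm
  rw [h9]
  linarith

theorem eigenvalue_le_one {ι : Type*} [Fintype ι] {v : ι → L2R} {ν : ι → ℝ} {a b : ℝ}
    (hv : Orthonormal ℂ v)
    (hν : ∀ i, timeFreqLoc a b (-1 / 2) (1 / 2) (v i) = (ν i : ℂ) • v i) (i : ι) : ν i ≤ 1 := by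
  have h0 := sq_nonneg ‖timeFreqLeak a b (v i)‖
  rw [norm_sq_timeFreqLeak_eigenvector hv hν i] at h0
  by_contra! h
  nlinarith

theorem abs_sub_le_of_prolateEigenvalue_mem_Ioo {D : ℝ} (hD : 0 < D) (hε : 0 < ε)
    (hε2 : ε < 1 / 2) (hκ : (1 / 9) ^ n * (8 * Real.log (1 + D)) + 8 * (D * (1 / 2) ^ M) ≤ ε / 2)
    {k : ℕ} (hk : 1 ≤ k) (hmem : prolateEigenvalue D k ∈ Set.Ioo ε (1 - ε)) :
    |(k : ℝ) - D| ≤ 4 * M * n + 16 * Real.log (1 + D) := by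
  obtain ⟨r, rfl⟩ : ∃ r, D = 2 * r := ⟨D / 2, by ring⟩
  have hr : 0 < r := by linarith
  have hκ' : (1 / 9) ^ n * (8 * Real.log (1 + 2 * r)) + 16 * (r * (1 / 2) ^ M) ≤ ε / 2 := by
    linarith
  have e1 : -(2 * r) / 2 = -r := by ring
  have e2 : 2 * r / 2 = r := by ring
  rw [prolateEigenvalue, eigenvalueSeq, e1, e2] at hmem
  set S : Set ℝ := {μ : ℝ | 0 < μ ∧ ∃ v : Fin k → L2R, Orthonormal ℂ v ∧
    ∀ i, ∃ ν : ℝ, μ ≤ ν ∧ timeFreqLoc (-r) r (-1 / 2) (1 / 2) (v i) = (ν : ℂ) • v i} with hS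
  obtain ⟨hlo, hhi⟩ := hmem
  -- An empty set has `sSup` equal to `0`, which is not above `ε`.
  have hne : S.Nonempty := by
    by_contra h
    rw [Set.not_nonempty_iff_eq_empty.mp h, Real.sSup_empty] at hlo
    linarith
  -- Here `k ≥ 1` matters: for `k = 0` the eigenvector condition is vacuous and the set is
  -- unbounded.
  have hbdd : BddAbove S := by
    refine ⟨1, ?_⟩
    rintro μ ⟨-, v, hv, hev⟩
    choose ν hμν hν using hev
    exact (hμν ⟨0, hk⟩).trans (eigenvalue_le_one hv hν _)
  rw [abs_sub_le_iff]
  constructor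
  · obtain ⟨μ, ⟨-, v, hv, hev⟩, hμ⟩ := exists_lt_of_lt_csSup hne hlo
    choose ν hμν hν using hev
    have h := card_le_of_eigenvalues_gt hr hε hε2 hκ' hv hν fun i => hμ.trans_le (hμν i)
    rw [Fintype.card_fin] at h
    linarith
  · have h := two_mul_le_of_forall_not_orthonormal hr hε hε2 hκ' (k := k) fun v hv => by
      by_contra! hc
      have hmem : 1 - ε ∈ S := ⟨by linarith, v, hv, hc⟩
      exact absurd (le_csSup hbdd hmem) (not_le.mpr hhi)
    linarith

end EigenvalueCount

/-! ### Choice of parameters and conclusion. -/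

/-- Passing to exponent `1 + η` could lose when `L < 1`; there `L ^ η ≥ √L ≥ 1/2`, so a factor `2`
suffices. -/
theorem le_two_mul_rpow {L η : ℝ} (hL : 1 / 4 ≤ L) (hη : 0 < η) (hη2 : η ≤ 1 / 2) :
    L ≤ 2 * L ^ (1 + η) := by
  have hL0 : 0 < L := by linarith
  have h : 1 / 2 ≤ L ^ η := by
    rcases le_or_gt 1 L with h1 | h1
    · linarith [Real.one_le_rpow h1 hη.le]
    · refine le_trans ?_ (Real.rpow_le_rpow_of_exponent_ge hL0 h1.le hη2)
      rw [← Real.sqrt_eq_rpow]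
      exact Real.le_sqrt_of_sq_le (by linarith)
  rw [Real.rpow_add hL0, Real.rpow_one]
  nlinarith

theorem exists_truncation_parameters {ε D : ℝ} (hε : 0 < ε) (hε2 : ε < 1 / 2) (hD : 2 ≤ D) :
    1 / 4 ≤ Real.log (Real.log D * ε⁻¹) ∧ ∃ M n : ℕ,
      (1 / 9) ^ n * (8 * Real.log (1 + D)) + 8 * (D * (1 / 2) ^ M) ≤ ε / 2 ∧
      4 * M * n + 16 * Real.log (1 + D)
        ≤ 1128 * Real.log (Real.log D * ε⁻¹) * Real.log (D * ε⁻¹) := by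
  have hinv : 2 < ε⁻¹ := by
    rw [lt_inv_comm₀ (by norm_num) hε]
    linarith
  have hl2 := Real.log_two_gt_d9
  have hl2' := Real.log_two_lt_d9
  have hlD : Real.log 2 ≤ Real.log D := Real.log_le_log (by norm_num) hD
  have hlD0 : 0 < Real.log D := by linarith
  have hl1D : Real.log (1 + D) ≤ 2 * Real.log D := by
    rw [← Real.log_rpow (by linarith)]
    refine Real.log_le_log (by linarith) ?_
    norm_num
    nlinarith
  set X := Real.log D * ε⁻¹ with hX
  set Y := D * ε⁻¹ with hY
  have hX1 : 4 / 3 ≤ X := by nlinarith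
  have hY4 : 4 ≤ Y := by nlinarith
  have hL : 1 / 4 ≤ Real.log X := by
    have h1 := Real.one_sub_inv_le_log_of_pos (by linarith : 0 < X)
    have h2 : X⁻¹ ≤ (4 / 3)⁻¹ := inv_anti₀ (by norm_num) hX1
    norm_num at h2
    linarith
  have hl : 1 ≤ Real.log Y := by
    have h1 : Real.log 4 ≤ Real.log Y := Real.log_le_log (by norm_num) hY4
    have h2 : Real.log 4 = 2 * Real.log 2 := by
      rw [← Real.log_rpow (by norm_num)]
      norm_num
    linarith
  have hlogDY : Real.log D ≤ Real.log Y := Real.log_le_log (by linarith) (by nlinarith)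
  have he := Real.exp_one_lt_d9
  -- Since `√e ≤ 2` and `e ≤ 9`, these choices give `2 ^ M ≥ 32 Y` and `9 ^ n ≥ 64 X`, which make
  -- each error term at most `ε/4`; the second uses `log(1 + D) ≤ 2 log D`.
  refine ⟨hL, ⌈2 * Real.log (32 * Y)⌉₊, ⌈Real.log (64 * X)⌉₊, ?_, ?_⟩
  · set M := ⌈2 * Real.log (32 * Y)⌉₊
    set n := ⌈Real.log (64 * X)⌉₊
    have h9 : 64 * X ≤ 9 ^ n := by
      calc 64 * X = Real.exp (Real.log (64 * X)) := (Real.exp_log (by linarith)).symm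
        _ ≤ Real.exp n := Real.exp_le_exp.mpr (Nat.le_ceil _)
        _ = Real.exp 1 ^ n := by rw [← Real.exp_nat_mul, mul_one]
        _ ≤ 9 ^ n := pow_le_pow_left₀ (Real.exp_pos _).le (by linarith) n
    have h2 : 32 * Y ≤ 2 ^ M := by
      calc 32 * Y = Real.exp (Real.log (32 * Y)) := (Real.exp_log (by linarith)).symm
        _ ≤ Real.exp (M * (1 / 2)) := Real.exp_le_exp.mpr (by
            have := Nat.le_ceil (2 * Real.log (32 * Y))
            change _ ≤ (M : ℝ) at this
            linarith)
        _ = Real.exp (1 / 2) ^ M := Real.exp_nat_mul _ _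
        _ ≤ 2 ^ M := by
            refine pow_le_pow_left₀ (Real.exp_pos _).le ?_ M
            have h : Real.exp (1 / 2) ^ 2 = Real.exp 1 := by
              rw [← Real.exp_nat_mul]
              norm_num
            nlinarith [Real.exp_pos (1 / 2 : ℝ)]
    have hXε : X * ε = Real.log D := by rw [hX]; field_simp
    have hYε : Y * ε = D := by rw [hY]; field_simp
    have h9' : (1 / 9 : ℝ) ^ n * (8 * Real.log (1 + D)) ≤ ε / 4 := by
      rw [one_div, inv_pow, inv_mul_le_iff₀ (by positivity)]
      nlinarith
    have h2' : 8 * (D * (1 / 2) ^ M) ≤ ε / 4 := by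
      rw [one_div, inv_pow, ← mul_assoc, mul_inv_le_iff₀ (by positivity)]
      nlinarith
    linarith
  · have hM : (⌈2 * Real.log (32 * Y)⌉₊ : ℝ) ≤ 10 * Real.log Y := by
      have h1 := Nat.ceil_lt_add_one (a := 2 * Real.log (32 * Y))
        (mul_nonneg (by norm_num) (Real.log_nonneg (by linarith)))
      have h2 : Real.log 32 = 5 * Real.log 2 := by
        rw [← Real.log_rpow (by norm_num)]
        norm_num
      rw [Real.log_mul (by norm_num) (by linarith)] at h1 ⊢
      linarith
    have hn : (⌈Real.log (64 * X)⌉₊ : ℝ) ≤ 25 * Real.log X := by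
      have h1 := Nat.ceil_lt_add_one (a := Real.log (64 * X)) (Real.log_nonneg (by linarith))
      have h2 : Real.log 64 = 6 * Real.log 2 := by
        rw [← Real.log_rpow (by norm_num)]
        norm_num
      rw [Real.log_mul (by norm_num) (by linarith)] at h1 ⊢
      linarith
    -- The constant is `1128 = 4 · 10 · 25 + 128`: as `log X ≥ 1/4`, one has `16 log(1 + D) ≤ 32 log
    -- Y ≤ 128 log X log Y`.
    have h3 := mul_le_mul hM hn (Nat.cast_nonneg _) (by linarith)
    nlinarith

theorem theorem2 :
    ∀ η : ℝ, 0 < η → η ≤ 1 / 2 →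
      ∃ A : ℝ, 1 ≤ A ∧
        ∀ ε D K : ℝ, 0 < ε → ε < 1 / 2 → 2 ≤ D →
          K = A * Real.log (Real.log D * ε⁻¹) ^ (1 + η) * Real.log (D * ε⁻¹) →
            ∀ k : ℕ, 1 ≤ k → prolateEigenvalue D k ∈ Set.Ioo ε (1 - ε) →
              (k : ℝ) ∈ Set.Icc (D - K) (D + K) := by
  intro η hη hη2
  -- `2256 = 2 · 1128`, the factor `2` coming from `le_two_mul_rpow`; it serves every `η`.
  refine ⟨2256, by norm_num, fun ε D K hε hε2 hD hK k hk hmem => ?_⟩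
  obtain ⟨hL, M, n, hκ, hMn⟩ := exists_truncation_parameters hε hε2 hD
  have h := (abs_sub_le_of_prolateEigenvalue_mem_Ioo (by linarith) hε hε2 hκ hk hmem).trans hMn
  have hlog : 0 ≤ Real.log (D * ε⁻¹) := by
    refine Real.log_nonneg ?_
    have : 1 ≤ ε⁻¹ := (one_le_inv₀ hε).mpr (by linarith)
    nlinarith
  have hle : |(k : ℝ) - D| ≤ K := by
    rw [hK]
    refine h.trans (mul_le_mul_of_nonneg_right ?_ hlog)
    linarith [le_two_mul_rpow hL hη hη2]
  rw [abs_le] at hle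
  exact ⟨by linarith, by linarith⟩
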